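/- Let $G$ be a group, let $A,B$ be sets with chosen elements $a_0\in A$, $b_0\in B$, and let $C\colon B\times A\to G$ be a matrix normalized with respect to $a_0,b_0$, i.e. $C_{b_0a}=1=C_{ba_0}$ for all $a\in A$, $b\in B$. Let $S=\mathcal M(G,A,B,C)$ be the Rees matrix semigroup: the set $A\times G\times B$ with multiplication $(a,g,b)(a',g',b')=(a,gC_{ba'}g',b')$ (by Rees's theorem, every completely simple semigroup is isomorphic to one of this form). For a monoid $M$ put $H_n(M)=\mathrm{Tor}_n^{\mathbb ZM}(\mathbb Z,\mathbb Z)$, where $\mathbb Z$ is the trivial module, and put $H_n(S)=H_n(S^1)$, where $S^1$ is $S$ with an identity adjoined. Put $\overline A=A\setminus\{a_0\}$, $\overline B=B\setminus\{b_0\}$, $G^{\mathrm{ab}}=G/[G,G]$, and let $\psi\colon\mathbb Z[\overline A\times\overline B]\to G^{\mathrm{ab}}$ be the homomorphism from the free abelian group on $\overline A\times\overline B$ with $\psi(a,b)=C_{ba}[G,G]$. Then, up to isomorphism of abelian groups, \[H_n(S)\cong\begin{cases}\mathbb Z,& n=0\\ \operatorname{coker}\psi,& n=1\\ H_2(G)\oplus\ker\psi,&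 n=2\\ H_n(G),& n\ge 3.\end{cases}\] In particular, if the subgroup $\langle C_{ba}[G,G]\mid (a,b)\in\overline A\times\overline B\rangle$ of $G^{\mathrm{ab}}$ is finite (for example if $G$ is finite, or if $C_{ba}=1$ for all $(a,b)\in\overline A\times\overline B$), then $\ker\psi\cong\mathbb Z[\overline A\times\overline B]$, i.e. $\ker\psi$ is free abelian of rank $|\overline A\times\overline B|$, and hence $H_2(S)\cong H_2(G)\oplus\mathbb Z[\overline A\times\overline B]$. -/

import Mathlib

open CategoryTheory

universe u v w

/-- There are enough projective `ℤ`-linear representations (i.e. `ℤM`-modules) in the universe of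
the monoid `M`. -/
instance repIntEnoughProjectives (M : Type u) [Monoid M] :
    EnoughProjectives (Rep.{u} ℤ M) :=
  Rep.equivalenceModuleMonoidAlgebra.enoughProjectives_iff.2 ModuleCat.enoughProjectives.{u}

/-- The `n`-th (Eilenberg-Mac Lane) homology `H_n(M) = Tor_n^{ℤM}(ℤ, ℤ)` of a monoid `M`.
Left `ℤM`-modules are `ℤ`-linear representations of `M`; the functor `ℤ ⊗_{ℤM} -` is the
coinvariants functor `V ↦ V_M = V / ⟨m v - v⟩`; and `H_n(M)` is its `n`-th left derived functor at
the trivial module `ℤ`, i.e. `H_n((P_•)_M)` for any projective resolution `P_• → ℤ`.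
(`ULift` only moves `ℤ` to the universe of `M`.) -/
noncomputable def monoidHomology (M : Type u) [Monoid M] (n : ℕ) : ModuleCat.{u} ℤ :=
  ((Rep.coinvariantsFunctor.{u} ℤ M).leftDerived n).obj (Rep.trivial ℤ M (ULift.{u} ℤ))

/-- The homology of a semigroup `S` is that of the monoid `S¹`, which is `S` with an identity
adjoined. -/
noncomputable def semigroupHomology (S : Type u) [Semigroup S] (n : ℕ) : ModuleCat.{u} ℤ :=
  monoidHomology (WithOne S) n

/-- The underlying set `A × G × B` of the Rees matrix semigroup `M(G, A, B, C)` with sandwich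
matrix `C : B × A → G`. -/
@[ext]
structure ReesMatrixSemigroup (G : Type u) (A : Type v) (B : Type w) (C : Matrix B A G) where
  /-- the `A`-coordinate -/
  row : A
  /-- the group coordinate -/
  val : G
  /-- the `B`-coordinate -/
  col : B

namespace ReesMatrixSemigroup

variable {G : Type u} {A : Type v} {B : Type w} [Group G]

/-- `(a, g, b) (a', g', b') = (a, g C_{b a'} g', b')`. -/
instance (C : Matrix B A G) : Semigroup (ReesMatrixSemigroup G A B C) where
  mul x y := ⟨x.row, x.val * C x.col y.row * y.val, y.col⟩
  mul_assoc x y z := by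
    change (⟨_, _, _⟩ : ReesMatrixSemigroup G A B C) = ⟨_, _, _⟩
    congr 1
    change x.val * C x.col y.row * y.val * C y.col z.row * z.val
      = x.val * C x.col y.row * (y.val * C y.col z.row * z.val)
    simp only [mul_assoc]

/-- The matrix `C` is normalized with respect to `a₀` and `b₀`:
`C_{b₀ a} = 1 = C_{b a₀}` for all `a` and `b`. -/
def IsNormalized (C : Matrix B A G) (a₀ : A) (b₀ : B) : Prop :=
  (∀ a, C b₀ a = 1) ∧ (∀ b, C b a₀ = 1)

/-- The homomorphism `ψ : ℤ[(A ∖ {a₀}) × (B ∖ {b₀})] → G^ab` with `ψ(a, b) = C_{ba} [G, G]`,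
where `G^ab` is written additively. -/
noncomputable def psi (C : Matrix B A G) (a₀ : A) (b₀ : B) :
    (({a : A // a ≠ a₀} × {b : B // b ≠ b₀}) →₀ ℤ) →ₗ[ℤ] Additive (Abelianization G) :=
  Finsupp.linearCombination ℤ fun p => Additive.ofMul (Abelianization.of (C p.2 p.1))

end ReesMatrixSemigroup

/-! Put e = (a₀, 1, b₀), an idempotent with eSe ≅ G. Since Se ≅ A × G, inducing the standard
resolution of the group G up to S¹ gives projective modules k[A × Gⁿ⁺¹], n ≥ 0. The resulting
complex resolves k[A], not k (`exists_rowD_eq`).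

Every s ∈ S sends all of A to the single element `s.row`, so S annihilates the kernel of k[A] → k.
This kernel is therefore a direct sum, with generators a - a₀ for a ∈ Ā, of copies of kS¹/kS. That
module has the projective resolution 0 → kS(1 - e) → kS¹(1 - e). By normalization, kS(1 - e) has the
basis (a', g, b) - (a', g, b₀) with b ≠ b₀, so it is a sum of copies of kSe indexed by B̄. The
mapping cone of the two resolutions is a resolution of k (`resolution`): it adds copies of kS¹(1 -
e) in degree 1 and k[A × G × Ā × B̄] in degree 2 to the induced complex.

Under coinvariants k[A × Gⁿ] becomes k[Gⁿ/G], kS¹(1 - e) vanishes and k[A × G × Ā × B̄] becomes k[Ā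
× B̄]. What remains is the standard complex of G with one extra 2-cell for each (a, b), whose
boundary is the 1-cycle of C_{ba}. Over ℤ, identifying H₁(G) with G^ab turns the boundary of these
cells into ψ: the cells divide im ψ out of H₁, add ker ψ to H₂, and change nothing else. The
extension in degree 2 splits because ker ψ, a subgroup of a free abelian group, is free
(`Submodule.free_of_finsupp`). If im ψ is finite, ker ψ contains a nonzero multiple of the whole
group and so has full rank. -/

section

open Representation

/-! ### Homology of three-term sequences of modules. -/

/-- The homology `ker g / im f` at the middle term of `X → Y → Z`. -/
abbrev MiddleHomology {R X Y Z : Type*} [Ring R] [AddCommGroup X] [AddCommGroup Y]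
    [AddCommGroup Z] [Module R X] [Module R Y] [Module R Z] (f : X →ₗ[R] Y) (g : Y →ₗ[R] Z) :
    Type _ :=
  LinearMap.ker g ⧸ (LinearMap.range f).comap (LinearMap.ker g).subtype

namespace MiddleHomology

variable {R X Y Z X' Y' Z' : Type*} [Ring R] [AddCommGroup X] [AddCommGroup Y] [AddCommGroup Z]
  [AddCommGroup X'] [AddCommGroup Y'] [AddCommGroup Z'] [Module R X] [Module R Y] [Module R Z]
  [Module R X'] [Module R Y'] [Module R Z']

/-- A linear map from `ker g` that is onto and has kernel `im f` computes the homology at `Y`. -/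
theorem nonempty_addEquiv_of_surjective {W : Type*} [AddCommGroup W] [Module R W] (f : X →ₗ[R] Y)
    (g : Y →ₗ[R] Z) (φ : LinearMap.ker g →ₗ[R] W) (hφ : Function.Surjective φ)
    (hker : ∀ y : LinearMap.ker g, φ y = 0 ↔ ∃ x, f x = y) :
    Nonempty (MiddleHomology f g ≃+ W) := by
  have h : (LinearMap.range f).comap (LinearMap.ker g).subtype = LinearMap.ker φ := by
    ext y
    rw [LinearMap.mem_ker, hker]
    rfl
  exact ⟨((Submodule.quotEquivOfEq _ _ h).trans
    (φ.quotKerEquivOfSurjective hφ)).toAddEquiv⟩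

/-- Isomorphic three-term sequences have isomorphic homology. -/
theorem nonempty_addEquiv_of_equiv {f : X →ₗ[R] Y} {g : Y →ₗ[R] Z} {f' : X' →ₗ[R] Y'}
    {g' : Y' →ₗ[R] Z'} (a : X ≃ₗ[R] X') (b : Y ≃ₗ[R] Y') (c : Z ≃ₗ[R] Z')
    (hf : ∀ x, b (f x) = f' (a x)) (hg : ∀ y, c (g y) = g' (b y)) :
    Nonempty (MiddleHomology f g ≃+ MiddleHomology f' g') := by
  refine nonempty_addEquiv_of_surjective f g
    ((Submodule.mkQ _).comp ((b.toLinearMap.comp (LinearMap.ker g).subtype).codRestrict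
      (LinearMap.ker g') fun y => ?_)) ?_ fun y => ?_
  · have := y.2
    rw [LinearMap.mem_ker] at this
    simp [← hg, this]
  · rintro x
    obtain ⟨⟨x, hx⟩, rfl⟩ := Submodule.Quotient.mk_surjective _ x
    refine ⟨⟨b.symm x, ?_⟩, ?_⟩
    · rw [LinearMap.mem_ker] at hx ⊢
      apply c.injective
      simp [hg, hx]
    · rw [LinearMap.comp_apply, Submodule.mkQ_apply]
      congr 1
      exact Subtype.ext (b.apply_symm_apply x)
  · rw [LinearMap.comp_apply, Submodule.mkQ_apply, Submodule.Quotient.mk_eq_zero,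
      Submodule.mem_comap]
    constructor
    · rintro ⟨x, hx⟩
      refine ⟨a.symm x, b.injective ?_⟩
      rw [hf, a.apply_symm_apply]
      exact hx
    · rintro ⟨x, hx⟩
      exact ⟨a x, by rw [← hf, hx]; rfl⟩

theorem nonempty_homology_addEquiv {R : Type*} [Ring R] (S : ShortComplex (ModuleCat.{u} R)) :
    Nonempty (S.homology ≃+ MiddleHomology S.f.hom S.g.hom) := by
  refine ⟨S.moduleCatHomologyIso.toLinearEquiv.toAddEquiv.trans
    (Submodule.quotEquivOfEq _ _ ?_).toAddEquiv⟩
  ext x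
  simp only [LinearMap.mem_range, Submodule.mem_comap]
  exact exists_congr fun y => Subtype.ext_iff

end MiddleHomology

/-! ### Concrete models of coinvariants. -/

namespace Representation

variable {k M V V' W W' : Type*} [CommRing k] [Monoid M] [AddCommGroup V] [AddCommGroup V']
  [AddCommGroup W] [AddCommGroup W'] [Module k V] [Module k V'] [Module k W] [Module k W']
  (ρ : Representation k M V) (ρ' : Representation k M V')

/-- A linear map exhibits its target as the coinvariants of a representation. -/
structure IsCoinvariants (q : V →ₗ[k] W) : Prop where
  surjective : Function.Surjective q
  eq_zero_iff : ∀ x, q x = 0 ↔ Coinvariants.mk ρ x = 0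

namespace IsCoinvariants

variable {ρ ρ'} {q : V →ₗ[k] W} {q' : V' →ₗ[k] W'}

/-- The identification of the coinvariants. -/
noncomputable def equiv (h : ρ.IsCoinvariants q) : ρ.Coinvariants ≃ₗ[k] W :=
  (Submodule.quotEquivOfEq _ _ (by
    ext x; rw [LinearMap.mem_ker, h.eq_zero_iff, Coinvariants.mk_eq_zero])).trans
    (q.quotKerEquivOfSurjective h.surjective)

/-- Invariance of `q` bounds its kernel from below; the factorization of `Coinvariants.mk ρ` through
`q` bounds it from above. -/
theorem of_exists_comp (q : V →ₗ[k] W) (hq : Function.Surjective q) (h : ∀ m, q ∘ₗ ρ m = q)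
    (hker : ∃ r : W →ₗ[k] ρ.Coinvariants, Coinvariants.mk ρ = r ∘ₗ q) : ρ.IsCoinvariants q := by
  refine ⟨hq, fun x => ⟨fun hx => ?_, fun hx => ?_⟩⟩
  · obtain ⟨r, hr⟩ := hker
    rw [hr, LinearMap.comp_apply, hx, map_zero]
  · rw [← Coinvariants.lift_mk ρ q h, hx, map_zero]

theorem comp_apply (h : ρ.IsCoinvariants q) (m : M) : q ∘ₗ ρ m = q := by
  ext x
  rw [← sub_eq_zero, LinearMap.comp_apply, ← map_sub, h.eq_zero_iff, map_sub,
    Coinvariants.mk_self_apply, sub_self]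

theorem mk_inl (x : V) (hx : Coinvariants.mk ρ x = 0) :
    Coinvariants.mk (ρ.prod ρ') (x, 0) = 0 := by
  have h := congr(Coinvariants.lift ρ (Coinvariants.mk (ρ.prod ρ') ∘ₗ LinearMap.inl k V V')
    (fun m => LinearMap.ext fun x => by
      simpa using Coinvariants.mk_self_apply (ρ.prod ρ') m (x, 0)) $hx)
  simpa using h

theorem mk_inr (x : V') (hx : Coinvariants.mk ρ' x = 0) :
    Coinvariants.mk (ρ.prod ρ') (0, x) = 0 := by
  have h := congr(Coinvariants.lift ρ' (Coinvariants.mk (ρ.prod ρ') ∘ₗ LinearMap.inr k V V')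
    (fun m => LinearMap.ext fun x => by
      simpa using Coinvariants.mk_self_apply (ρ.prod ρ') m (0, x)) $hx)
  simpa using h

theorem mk_prod_eq_zero (x : V) (y : V') (hx : Coinvariants.mk ρ x = 0)
    (hy : Coinvariants.mk ρ' y = 0) : Coinvariants.mk (ρ.prod ρ') (x, y) = 0 := by
  rw [← zero_add y, ← add_zero x, ← Prod.mk_add_mk, map_add,
    mk_inl x hx, mk_inr y hy, add_zero]

theorem prodMap (h : ρ.IsCoinvariants q) (h' : ρ'.IsCoinvariants q') :
    (ρ.prod ρ').IsCoinvariants (q.prodMap q') := by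
  refine ⟨h.surjective.prodMap h'.surjective, fun x => ⟨fun hx => ?_, fun hx => ?_⟩⟩
  · obtain ⟨h1, h2⟩ := Prod.ext_iff.1 hx
    exact mk_prod_eq_zero _ _ ((h.eq_zero_iff _).1 h1) ((h'.eq_zero_iff _).1 h2)
  · have := congr(Coinvariants.lift (ρ.prod ρ') (q.prodMap q') (fun m => LinearMap.ext fun x =>
      Prod.ext (LinearMap.congr_fun (h.comp_apply m) x.1)
        (LinearMap.congr_fun (h'.comp_apply m) x.2)) $hx)
    rwa [map_zero] at this

theorem comp_fst (h : ρ.IsCoinvariants q) (h' : ∀ x, Coinvariants.mk ρ' x = 0) :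
    (ρ.prod ρ').IsCoinvariants (q ∘ₗ LinearMap.fst k V V') := by
  refine ⟨h.surjective.comp Prod.fst_surjective, fun x => ⟨fun hx => ?_, fun hx => ?_⟩⟩
  · exact mk_prod_eq_zero _ _ ((h.eq_zero_iff _).1 hx) (h' _)
  · have := congr(Coinvariants.lift (ρ.prod ρ') (q ∘ₗ LinearMap.fst k V V')
      (fun m => LinearMap.ext fun x => LinearMap.congr_fun (h.comp_apply m) x.1) $hx)
    rwa [map_zero] at this

end IsCoinvariants

end Representation

/-! ### Derived functors of coinvariants from elementwise resolutions. -/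

/-- A projective resolution of a representation, in terms of elements. -/
structure ElementwiseResolution {k : Type} [CommRing k] {M : Type u} [Monoid M]
    (Z : Rep.{u} k M) where
  /-- the terms of the resolution -/
  X : ℕ → Rep.{u} k M
  /-- the differentials -/
  d : ∀ n, X (n + 1) ⟶ X n
  /-- the augmentation -/
  ε : X 0 ⟶ Z
  projective : ∀ n, Projective (X n)
  d_d : ∀ n (x : X (n + 2)), (d n).hom ((d (n + 1)).hom x) = 0
  ε_d : ∀ x : X 1, ε.hom ((d 0).hom x) = 0
  ε_surjective : Function.Surjective ε.hom
  exact_zero : ∀ x : X 0, ε.hom x = 0 → ∃ y, (d 0).hom y = x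
  exact_succ : ∀ n (x : X (n + 1)), (d n).hom x = 0 → ∃ y, (d (n + 1)).hom y = x

section

variable {k : Type} [CommRing k] {M : Type u} [Monoid M]

theorem Rep.shortComplex_exact {S : ShortComplex (Rep.{u} k M)}
    (h : ∀ x : S.X₂, S.g.hom x = 0 → ∃ y, S.f.hom y = x) : S.Exact := by
  rw [← ShortComplex.exact_map_iff_of_faithful S (forget₂ (Rep.{u} k M) (ModuleCat.{u} k)),
    ShortComplex.moduleCat_exact_iff]
  exact h

namespace ElementwiseResolution

variable {Z : Rep.{u} k M} (R : ElementwiseResolution Z)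

/-- The chain complex underlying a resolution. -/
noncomputable def complex : ChainComplex (Rep.{u} k M) ℕ :=
  ChainComplex.of R.X R.d fun n => Rep.hom_ext <| IntertwiningMap.ext <|
    LinearMap.ext fun x => R.d_d n x

theorem complex_d (n : ℕ) : R.complex.d (n + 1) n = R.d n :=
  ChainComplex.of_d ..

theorem complex_d_ε : R.complex.d 1 0 ≫ R.ε = 0 := by
  rw [complex_d]
  exact Rep.hom_ext <| IntertwiningMap.ext <| LinearMap.ext fun x => R.ε_d x

/-- The augmentation as a map of complexes. -/
noncomputable def toSingle : R.complex ⟶ (ChainComplex.single₀ _).obj Z :=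
  (R.complex.toSingle₀Equiv _).symm ⟨R.ε, R.complex_d_ε⟩

theorem complex_d_hom_apply (n : ℕ) (x : R.X (n + 1)) :
    (R.complex.d (n + 1) n).hom x = (R.d n).hom x := by
  rw [complex_d]
  rfl

theorem exact_augmented : (ShortComplex.mk (R.complex.d 1 0) R.ε R.complex_d_ε).Exact := by
  refine Rep.shortComplex_exact fun x hx => ?_
  obtain ⟨y, hy⟩ := R.exact_zero x hx
  exact ⟨y, (R.complex_d_hom_apply 0 y).trans hy⟩

theorem exactAt_succ (n : ℕ) : R.complex.ExactAt (n + 1) := by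
  rw [HomologicalComplex.exactAt_iff' _ (n + 2) (n + 1) n (by simp) (by simp)]
  refine Rep.shortComplex_exact fun x hx => ?_
  obtain ⟨y, hy⟩ := R.exact_succ n x ((R.complex_d_hom_apply n x).symm.trans hx)
  exact ⟨y, (R.complex_d_hom_apply (n + 1) y).trans hy⟩

theorem quasiIso_toSingle : QuasiIso R.toSingle := by
  refine ⟨fun n => ?_⟩
  cases n with
  | zero =>
    rw [ChainComplex.quasiIsoAt₀_iff, ShortComplex.quasiIso_iff_of_zeros']
    · refine (ShortComplex.exact_and_epi_g_iff_of_iso ?_).2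
          ⟨R.exact_augmented, (Rep.epi_iff_surjective _).2 R.ε_surjective⟩
      refine ShortComplex.isoMk (Iso.refl _) (Iso.refl _) (Iso.refl _) ?_ ?_
      · exact (Category.id_comp _).trans (Category.comp_id _).symm
      · refine (Category.id_comp _).trans (.trans ?_ (Category.comp_id _).symm)
        exact (ChainComplex.toSingle₀Equiv_symm_apply_f_zero (C := R.complex) R.ε R.complex_d_ε).symm
    all_goals rfl
  | succ n =>
    rw [quasiIsoAt_iff_exactAt']
    · exact R.exactAt_succ n
    · apply ChainComplex.exactAt_succ_single_obj

/-- The projective resolution in the sense of homological algebra. -/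
noncomputable def projectiveResolution : ProjectiveResolution Z where
  complex := R.complex
  projective := R.projective
  π := R.toSingle
  quasiIso := R.quasiIso_toSingle

variable [EnoughProjectives (Rep.{u} k M)]

theorem nonempty_leftDerived_succ (n : ℕ) : Nonempty
    (((Rep.coinvariantsFunctor.{u} k M).leftDerived (n + 1)).obj Z ≃+
      MiddleHomology (Coinvariants.map _ _ (R.d (n + 1)).hom)
        (Coinvariants.map _ _ (R.d n).hom)) := by
  let K := ((Rep.coinvariantsFunctor.{u} k M).mapHomologicalComplex _).obj R.complex
  let e := R.projectiveResolution.isoLeftDerivedObj (Rep.coinvariantsFunctor.{u} k M) (n + 1) ≪≫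
    K.homologyIsoSc' (n + 2) (n + 1) n (by simp) (by simp)
  obtain ⟨e'⟩ := MiddleHomology.nonempty_homology_addEquiv (K.sc' (n + 2) (n + 1) n)
  have h (n : ℕ) : K.d (n + 1) n = (Rep.coinvariantsFunctor.{u} k M).map (R.d n) := by
    rw [← complex_d]; rfl
  obtain ⟨e''⟩ := MiddleHomology.nonempty_addEquiv_of_equiv
    (f := (K.sc' (n + 2) (n + 1) n).f.hom) (g := (K.sc' (n + 2) (n + 1) n).g.hom)
    (f' := Coinvariants.map _ _ (R.d (n + 1)).hom) (g' := Coinvariants.map _ _ (R.d n).hom)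
    (LinearEquiv.refl k _) (LinearEquiv.refl k _) (LinearEquiv.refl k _)
    (fun x => congr($(h (n + 1)).hom x)) (fun x => congr($(h n).hom x))
  exact ⟨e.toLinearEquiv.toAddEquiv.trans (e'.trans e'')⟩

theorem nonempty_leftDerived_zero : Nonempty
    (((Rep.coinvariantsFunctor.{u} k M).leftDerived 0).obj Z ≃+
      MiddleHomology (Coinvariants.map _ _ (R.d 0).hom)
        (0 : (R.X 0).ρ.Coinvariants →ₗ[k] (R.X 0).ρ.Coinvariants)) := by
  let K := ((Rep.coinvariantsFunctor.{u} k M).mapHomologicalComplex _).obj R.complex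
  let e := R.projectiveResolution.isoLeftDerivedObj (Rep.coinvariantsFunctor.{u} k M) 0 ≪≫
    -- Nothing follows degree 0 in the complex, so its successor index is 0 itself, with zero
    -- differential.
    K.homologyIsoSc' 1 0 0 (by simp) (by simp)
  obtain ⟨e'⟩ := MiddleHomology.nonempty_homology_addEquiv (K.sc' 1 0 0)
  have h : K.d 1 0 = (Rep.coinvariantsFunctor.{u} k M).map (R.d 0) := by
    rw [← complex_d]; rfl
  have h0 : K.d 0 0 = 0 := K.shape _ _ (by simp)
  obtain ⟨e''⟩ := MiddleHomology.nonempty_addEquiv_of_equiv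
    (f := (K.sc' 1 0 0).f.hom) (g := (K.sc' 1 0 0).g.hom)
    (f' := Coinvariants.map _ _ (R.d 0).hom)
    (g' := (0 : (R.X 0).ρ.Coinvariants →ₗ[k] (R.X 0).ρ.Coinvariants))
    (LinearEquiv.refl k _) (LinearEquiv.refl k _) (LinearEquiv.refl k _)
    (fun x => congr($(h).hom x)) (fun x => congr($(h0).hom x))
  exact ⟨e.toLinearEquiv.toAddEquiv.trans (e'.trans e'')⟩

variable {Y₀ Y₁ Y₂ : Type*} [AddCommGroup Y₀] [AddCommGroup Y₁] [AddCommGroup Y₂]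
  [Module k Y₀] [Module k Y₁] [Module k Y₂]

/-- The left derived functors of the coinvariants are the homology of any complex of modules that
is isomorphic to the coinvariants of a resolution. -/
theorem nonempty_leftDerived_succ_of_isCoinvariants {n : ℕ} {q₀ : R.X n →ₗ[k] Y₀}
    {q₁ : R.X (n + 1) →ₗ[k] Y₁} {q₂ : R.X (n + 2) →ₗ[k] Y₂}
    (h₀ : (R.X n).ρ.IsCoinvariants q₀) (h₁ : (R.X (n + 1)).ρ.IsCoinvariants q₁)
    (h₂ : (R.X (n + 2)).ρ.IsCoinvariants q₂) {g : Y₁ →ₗ[k] Y₀} {f : Y₂ →ₗ[k] Y₁}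
    (hg : ∀ x, q₀ ((R.d n).hom x) = g (q₁ x))
    (hf : ∀ x, q₁ ((R.d (n + 1)).hom x) = f (q₂ x)) : Nonempty
      (((Rep.coinvariantsFunctor.{u} k M).leftDerived (n + 1)).obj Z ≃+ MiddleHomology f g) := by
  obtain ⟨e⟩ := R.nonempty_leftDerived_succ n
  obtain ⟨e'⟩ := MiddleHomology.nonempty_addEquiv_of_equiv (f' := f) (g' := g)
    (f := Coinvariants.map _ _ (R.d (n + 1)).hom) (g := Coinvariants.map _ _ (R.d n).hom)
    h₂.equiv h₁.equiv h₀.equiv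
    (fun x => by induction x using Coinvariants.induction_on with | h x => exact hf x)
    (fun x => by induction x using Coinvariants.induction_on with | h x => exact hg x)
  exact ⟨e.trans e'⟩

theorem nonempty_leftDerived_zero_of_isCoinvariants {q₀ : R.X 0 →ₗ[k] Y₀}
    {q₁ : R.X 1 →ₗ[k] Y₁} (h₀ : (R.X 0).ρ.IsCoinvariants q₀) (h₁ : (R.X 1).ρ.IsCoinvariants q₁)
    {f : Y₁ →ₗ[k] Y₀} (hf : ∀ x, q₀ ((R.d 0).hom x) = f (q₁ x)) : Nonempty
      (((Rep.coinvariantsFunctor.{u} k M).leftDerived 0).obj Z ≃+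
        MiddleHomology f (0 : Y₀ →ₗ[k] Y₀)) := by
  obtain ⟨e⟩ := R.nonempty_leftDerived_zero
  obtain ⟨e'⟩ := MiddleHomology.nonempty_addEquiv_of_equiv (f' := f)
    (f := Coinvariants.map _ _ (R.d 0).hom)
    (g := (0 : (R.X 0).ρ.Coinvariants →ₗ[k] _)) (g' := (0 : Y₀ →ₗ[k] Y₀))
    h₁.equiv h₀.equiv h₀.equiv
    (fun x => by induction x using Coinvariants.induction_on with | h x => exact hf x) (by simp)
  exact ⟨e.trans e'⟩

end ElementwiseResolution

end

theorem Rep.projective_of_retract {k : Type} [CommRing k] {M : Type u} [Monoid M]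
    {P Q : Rep.{u} k M} [Projective Q] (i : P ⟶ Q) (r : Q ⟶ P)
    (h : ∀ x, r.hom (i.hom x) = x) : Projective P :=
  Retract.projective (Y := Q) ⟨i, r, Rep.hom_ext <| IntertwiningMap.ext <| LinearMap.ext h⟩

/-- The equivariant map `i` is a section of the map from the free module given by `b`. No basis over
the monoid algebra is needed. -/
theorem Rep.projective_of_free_retract {k : Type} [CommRing k] {M I V : Type u} [Monoid M]
    [AddCommGroup V] [Module k V] (ρ : Representation k M V) (i : V →ₗ[k] (I →₀ MonoidAlgebra k M))
    (hi : ∀ m v, i (ρ m v) = Representation.free k M I m (i v)) (b : I → V)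
    (h : ∀ v, Representation.freeLift ρ b (i v) = v) : Projective (Rep.of ρ) :=
  Rep.projective_of_retract (Q := Rep.free k M I)
    (Rep.ofHom (LinearMap.intertwiningMap_of_isIntertwiningMap _ _ i hi))
    (Rep.freeLift k M (A := Rep.of ρ) b) h

theorem Finsupp.eq_smul_single_one {k X : Type*} [Semiring k] (x : X) (r : k) :
    single x r = r • single x 1 := by simp

/-! ### The standard complex of a group and its orbit complex. -/

section

variable (k : Type) [CommRing k] (G : Type u)

/-- The differential `k[Gⁿ⁺¹] → k[Gⁿ]`, the alternating sum of the maps that omit one coordinate,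
defined by recursion from `d (g, x) = x - (g, d x)`. -/
noncomputable def tupleD : ∀ n : ℕ, ((Fin (n + 1) → G) →₀ k) →ₗ[k] ((Fin n → G) →₀ k)
  | 0 => Finsupp.lmapDomain k k Fin.tail
  | n + 1 => Finsupp.linearCombination k fun x =>
      Finsupp.single (Fin.tail x) 1 -
        Finsupp.lmapDomain k k (fun y => Fin.cons (x 0) y : (Fin n → G) → (Fin (n + 1) → G))
          (tupleD n (Finsupp.single (Fin.tail x) 1))

variable {G}

/-- Prefixing a coordinate. -/
noncomputable def tupleCons (g : G) (n : ℕ) :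
    ((Fin n → G) →₀ k) →ₗ[k] ((Fin (n + 1) → G) →₀ k) :=
  Finsupp.lmapDomain k k (fun y => Fin.cons g y)

variable {k}

@[simp]
theorem tupleCons_single (g : G) (n : ℕ) (x : Fin n → G) (r : k) :
    tupleCons k g n (Finsupp.single x r) = Finsupp.single (Fin.cons g x) r :=
  Finsupp.mapDomain_single

theorem tupleD_zero_cons (g : G) (y : (Fin 0 → G) →₀ k) :
    tupleD k G 0 (tupleCons k g 0 y) = y := by
  induction y using Finsupp.induction_linear with
  | zero => simp
  | add x y hx hy => simp only [map_add, hx, hy]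
  | single x r => simp [tupleD]

theorem tupleD_succ_cons (n : ℕ) (g : G) (y : (Fin (n + 1) → G) →₀ k) :
    tupleD k G (n + 1) (tupleCons k g (n + 1) y) = y - tupleCons k g n (tupleD k G n y) := by
  induction y using Finsupp.induction_linear with
  | zero => simp
  | add x y hx hy => simp only [map_add, hx, hy]; abel
  | single x r =>
    rw [Finsupp.eq_smul_single_one, map_smul, map_smul, map_smul, map_smul, ← smul_sub]
    congr 1
    rw [tupleCons_single, tupleD, Finsupp.linearCombination_single, one_smul, Fin.tail_cons,
      Fin.cons_zero]
    rfl

/-- Prefixed chains span, and on them `tupleD` is given by its recursion; identities for the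
differential thus need no alternating sums. -/
theorem tuple_induction {n : ℕ} {p : ((Fin (n + 1) → G) →₀ k) → Prop} (x)
    (zero : p 0) (add : ∀ x y, p x → p y → p (x + y)) (cons : ∀ g y, p (tupleCons k g n y)) :
    p x := by
  induction x using Finsupp.induction_linear with
  | zero => exact zero
  | add x y hx hy => exact add x y hx hy
  | single x r =>
    have := cons (x 0) (Finsupp.single (Fin.tail x) r)
    rwa [tupleCons_single, Fin.cons_self_tail] at this

theorem tupleD_tupleD (n : ℕ) (x : (Fin (n + 2) → G) →₀ k) :
    tupleD k G n (tupleD k G (n + 1) x) = 0 := by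
  induction n with
  | zero =>
    induction x using tuple_induction with
    | zero => simp
    | cons g y => rw [tupleD_succ_cons, map_sub, tupleD_zero_cons, sub_self]
    | add x y hx hy => rw [map_add, map_add, hx, hy, add_zero]
  | succ n ih =>
    induction x using tuple_induction with
    | zero => simp
    | cons g y => rw [tupleD_succ_cons, map_sub, tupleD_succ_cons, ih, map_zero, sub_zero, sub_self]
    | add x y hx hy => rw [map_add, map_add, hx, hy, add_zero]

/-- Prefixing 1 is a contracting homotopy. -/
theorem tupleD_exact [One G] (n : ℕ) (x : (Fin (n + 1) → G) →₀ k) (hx : tupleD k G n x = 0) :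
    tupleD k G (n + 1) (tupleCons k 1 (n + 1) x) = x := by
  rw [tupleD_succ_cons, hx, map_zero, sub_zero]

variable [Group G]

theorem Fin.smul_cons (g h : G) {n : ℕ} (x : Fin n → G) :
    g • (Fin.cons h x : Fin (n + 1) → G) = Fin.cons (g * h) (g • x) := by
  ext i
  refine Fin.cases ?_ (fun i => ?_) i <;> simp

variable (k)

/-- The diagonal action on `k[Gⁿ]`. -/
noncomputable def tupleSMul (g : G) (n : ℕ) : ((Fin n → G) →₀ k) →ₗ[k] ((Fin n → G) →₀ k) :=
  Finsupp.lmapDomain k k (g • ·)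

variable {k}

@[simp]
theorem tupleSMul_single (g : G) (n : ℕ) (x : Fin n → G) (r : k) :
    tupleSMul k g n (Finsupp.single x r) = Finsupp.single (g • x) r :=
  Finsupp.mapDomain_single

theorem tupleSMul_cons (n : ℕ) (g h : G) (y : (Fin n → G) →₀ k) :
    tupleSMul k g (n + 1) (tupleCons k h n y) = tupleCons k (g * h) n (tupleSMul k g n y) := by
  induction y using Finsupp.induction_linear with
  | zero => simp
  | add x y hx hy => simp only [map_add, hx, hy]
  | single x r => simp [Fin.smul_cons]

theorem tupleD_smul (n : ℕ) (g : G) (x : (Fin (n + 1) → G) →₀ k) :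
    tupleD k G n (tupleSMul k g (n + 1) x) = tupleSMul k g n (tupleD k G n x) := by
  induction n with
  | zero =>
    induction x using tuple_induction with
    | zero => simp
    | cons h y => rw [tupleSMul_cons, tupleD_zero_cons, tupleD_zero_cons]
    | add x y hx hy => rw [map_add, map_add, map_add, map_add, hx, hy]
  | succ n ih =>
    induction x using tuple_induction with
    | zero => simp
    | cons h y =>
      rw [tupleSMul_cons, tupleD_succ_cons, tupleD_succ_cons, ih, map_sub, tupleSMul_cons]
    | add x y hx hy => rw [map_add, map_add, map_add, map_add, hx, hy]

variable (G)

/-- The orbits of the diagonal action on `Gⁿ`. -/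
abbrev TupleOrbit (n : ℕ) : Type u := MulAction.orbitRel.Quotient G (Fin n → G)

variable {G}

/-- The orbit of a tuple. -/
abbrev TupleOrbit.mk {n : ℕ} (x : Fin n → G) : TupleOrbit G n := Quotient.mk'' x

theorem TupleOrbit.mk_surjective {n : ℕ} :
    Function.Surjective (TupleOrbit.mk : (Fin n → G) → TupleOrbit G n) :=
  Quotient.mk''_surjective

theorem TupleOrbit.mk_eq_iff {n : ℕ} {x y : Fin n → G} : mk x = mk y ↔ ∃ g : G, g • y = x :=
  Quotient.eq''.trans MulAction.orbitRel_apply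

variable (k G)

/-- The projection `k[Gⁿ] → k[Gⁿ/G]`. -/
noncomputable def tupleProj (n : ℕ) : ((Fin n → G) →₀ k) →ₗ[k] (TupleOrbit G n →₀ k) :=
  Finsupp.lmapDomain k k TupleOrbit.mk

variable {k G}

@[simp]
theorem tupleProj_single (n : ℕ) (x : Fin n → G) (r : k) :
    tupleProj k G n (Finsupp.single x r) = Finsupp.single (TupleOrbit.mk x) r :=
  Finsupp.mapDomain_single

theorem tupleProj_smul (n : ℕ) (g : G) (x : (Fin n → G) →₀ k) :
    tupleProj k G n (tupleSMul k g n x) = tupleProj k G n x := by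
  induction x using Finsupp.induction_linear with
  | zero => simp
  | add x y hx hy => simp only [map_add, hx, hy]
  | single x r => simp

variable (k G)

/-- The differential `k[Gⁿ⁺¹/G] → k[Gⁿ/G]`. -/
noncomputable def orbitD (n : ℕ) : (TupleOrbit G (n + 1) →₀ k) →ₗ[k] (TupleOrbit G n →₀ k) :=
  Finsupp.linearCombination k (Quotient.lift
    (fun x => tupleProj k G n (tupleD k G n (Finsupp.single x 1))) (by
      rintro _ x ⟨g, rfl⟩
      simpa [← tupleD_smul] using tupleProj_smul n g (tupleD k G n (Finsupp.single x 1))))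

variable {k G}

theorem orbitD_proj (n : ℕ) (x : (Fin (n + 1) → G) →₀ k) :
    orbitD k G n (tupleProj k G (n + 1) x) = tupleProj k G n (tupleD k G n x) := by
  induction x using Finsupp.induction_linear with
  | zero => simp
  | add x y hx hy => simp only [map_add, hx, hy]
  | single x r =>
    rw [Finsupp.eq_smul_single_one, map_smul, map_smul, map_smul, map_smul, tupleProj_single,
      orbitD, Finsupp.linearCombination_single, one_smul]
    rfl

end

/-! ### Permutation modules and the standard resolution of a group. -/

/-- The coinvariants of a permutation module are free on the orbits. -/
theorem isCoinvariants_lmapDomain {k M X O : Type*} [CommRing k] [Monoid M]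
    (ρ : Representation k M (X →₀ k)) (π : X → O) (hπ : Function.Surjective π)
    (h : ∀ m x, Finsupp.lmapDomain k k π (ρ m (Finsupp.single x 1)) = Finsupp.single (π x) 1)
    (hmk : ∀ x y, π x = π y →
      Coinvariants.mk ρ (Finsupp.single x 1) = Coinvariants.mk ρ (Finsupp.single y 1)) :
    ρ.IsCoinvariants (Finsupp.lmapDomain k k π) := by
  refine .of_exists_comp _ (Finsupp.mapDomain_surjective hπ)
    (fun m => Finsupp.lhom_ext' fun x => LinearMap.ext_ring (by simpa using h m x))
    ⟨Finsupp.linearCombination k fun o =>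
      Coinvariants.mk ρ (Finsupp.single (Function.surjInv hπ o) 1), ?_⟩
  ext x
  simpa using hmk _ _ (Function.surjInv_eq hπ _).symm

section

variable (k : Type) [CommRing k] (G : Type u) [Group G]

/-- `k[Gⁿ]` with the diagonal action. -/
noncomputable def tupleRepresentation (n : ℕ) : Representation k G ((Fin n → G) →₀ k) where
  toFun g := tupleSMul k g n
  map_one' := Finsupp.lhom_ext' fun x => LinearMap.ext_ring (by simp)
  map_mul' g h := Finsupp.lhom_ext' fun x => LinearMap.ext_ring (by simp [mul_smul])

theorem tupleRepresentation_apply (n : ℕ) (g : G) :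
    tupleRepresentation k G n g = tupleSMul k g n := rfl

theorem projective_tupleRepresentation (n : ℕ) :
    Projective (Rep.of (tupleRepresentation k G (n + 1))) := by
  -- Each tuple is x = x₀ · (x₀⁻¹x), and x₀⁻¹x depends only on the orbit of x.
  refine Rep.projective_of_free_retract _ (Finsupp.linearCombination k fun x =>
    Finsupp.single ((x 0)⁻¹ • x) (MonoidAlgebra.single (x 0) 1)) (fun g v => ?_)
    (fun x => Finsupp.single x 1) fun x => ?_
  · induction v using Finsupp.induction_linear with
    | zero => simp
    | add x y hx hy => simp only [map_add, hx, hy]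
    | single x r => simp [tupleRepresentation_apply, smul_smul]
  · induction x using Finsupp.induction_linear with
    | zero => simp
    | add x y hx hy => simp only [map_add, hx, hy]
    | single x r => simp [tupleRepresentation_apply]

/-- `k[G⁰]` is `k`. -/
noncomputable def emptyTupleEquiv : ((Fin 0 → G) →₀ k) ≃ₗ[k] ULift.{u} k :=
  (Finsupp.uniqueLinearEquiv k k default).trans ULift.moduleEquiv.symm

/-- The standard resolution of the trivial module of a group. -/
noncomputable def groupResolution :
    ElementwiseResolution (Rep.trivial k G (ULift.{u} k)) where
  X n := Rep.of (tupleRepresentation k G (n + 1))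
  -- The index is shifted by one because `tupleD k G 0` is the augmentation.
  d n := Rep.ofHom (LinearMap.intertwiningMap_of_isIntertwiningMap _ _ (tupleD k G (n + 1))
    fun g v => tupleD_smul (n + 1) g v)
  ε := Rep.ofHom (LinearMap.intertwiningMap_of_isIntertwiningMap _ _
    ((emptyTupleEquiv k G).toLinearMap ∘ₗ tupleD k G 0) fun g v => by
      change emptyTupleEquiv k G (tupleD k G 0 (tupleSMul k g 1 v)) =
        emptyTupleEquiv k G (tupleD k G 0 v)
      have h : tupleSMul k g 0 = LinearMap.id :=
        Finsupp.lhom_ext' fun x => LinearMap.ext_ring (by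
          simp [Subsingleton.elim (g • x) x])
      rw [tupleD_smul, h, LinearMap.id_apply])
  projective := projective_tupleRepresentation k G
  d_d n := tupleD_tupleD (n + 1)
  ε_d x := by
    change emptyTupleEquiv k G (tupleD k G 0 (tupleD k G 1 x)) = 0
    rw [tupleD_tupleD, map_zero]
  ε_surjective :=
    show Function.Surjective (emptyTupleEquiv k G ∘ tupleD k G 0) from
      (LinearEquiv.surjective _).comp fun x => ⟨_, tupleD_zero_cons 1 x⟩
  exact_zero x hx := ⟨_, tupleD_exact 0 x ((emptyTupleEquiv k G).map_eq_zero_iff.1 hx)⟩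
  exact_succ n x hx := ⟨_, tupleD_exact (n + 1) x hx⟩

theorem isCoinvariants_tupleProj (n : ℕ) :
    (tupleRepresentation k G n).IsCoinvariants (tupleProj k G n) := by
  refine isCoinvariants_lmapDomain _ _ TupleOrbit.mk_surjective (fun g x => ?_) fun x y h => ?_
  · change tupleProj k G n (tupleSMul k g n _) = _
    simp
  · obtain ⟨g, rfl⟩ := TupleOrbit.mk_eq_iff.1 h
    have := Coinvariants.mk_self_apply (tupleRepresentation k G n) g (Finsupp.single y 1)
    rwa [tupleRepresentation_apply, tupleSMul_single] at this

theorem nonempty_leftDerived_group [EnoughProjectives (Rep.{u} k G)] (n : ℕ) :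
    Nonempty (((Rep.coinvariantsFunctor.{u} k G).leftDerived (n + 1)).obj
      (Rep.trivial k G (ULift.{u} k)) ≃+ MiddleHomology (orbitD k G (n + 2)) (orbitD k G (n + 1))) :=
  (groupResolution k G).nonempty_leftDerived_succ_of_isCoinvariants
    (isCoinvariants_tupleProj k G (n + 1)) (isCoinvariants_tupleProj k G (n + 2))
    (isCoinvariants_tupleProj k G (n + 3))
    (fun x => (orbitD_proj (n + 1) x).symm) (fun x => (orbitD_proj (n + 2) x).symm)

end

/-! ### Modules over a semigroup with identity adjoined. -/

section

variable {k S V W : Type*} [CommRing k] [Semigroup S] [AddCommGroup V] [Module k V]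
  [AddCommGroup W] [Module k W]

/-- A representation of a semigroup as a representation of the semigroup with identity adjoined. -/
def Representation.withOne (σ : S →ₙ* Module.End k V) : Representation k (WithOne S) V :=
  WithOne.lift σ

@[simp]
theorem Representation.withOne_coe (σ : S →ₙ* Module.End k V) (s : S) :
    withOne σ (s : WithOne S) = σ s :=
  WithOne.lift_coe _ _

theorem Representation.withOne_intertwining {ρ : Representation k (WithOne S) V}
    {τ : Representation k (WithOne S) W} (f : V → W) (h : ∀ (s : S) v, f (ρ s v) = τ s (f v))
    (m : WithOne S) (v : V) : f (ρ m v) = τ m (f v) := by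
  induction m using WithOne.recOneCoe with
  | one => simp
  | coe s => exact h s v

variable (k S) (Y : Type*) [SemigroupAction S Y]

/-- The permutation module of a semigroup action. -/
noncomputable def permRepresentation : Representation k (WithOne S) (Y →₀ k) :=
  withOne
    { toFun s := Finsupp.lmapDomain k k (s • ·)
      map_mul' s t := Finsupp.lhom_ext' fun x => LinearMap.ext_ring (by
        simp [SemigroupAction.mul_smul]) }

variable {k S Y}

@[simp]
theorem permRepresentation_coe_single (s : S) (y : Y) (r : k) :
    permRepresentation k S Y s (Finsupp.single y r) = Finsupp.single (s • y) r := by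
  simp [permRepresentation]

/-- Elements of S need not be invertible, so two points of a fibre are identified in the
coinvariants through a common point `z` that can be moved to both. -/
theorem isCoinvariants_permRepresentation {O : Type*} (π : Y → O) (hπ : Function.Surjective π)
    (h : ∀ (s : S) y, π (s • y) = π y)
    (hmk : ∀ x y, π x = π y → ∃ (z : Y) (s t : S), s • z = x ∧ t • z = y) :
    (permRepresentation k S Y).IsCoinvariants (Finsupp.lmapDomain k k π) := by
  refine isCoinvariants_lmapDomain _ _ hπ (fun m y => ?_) fun x y hxy => ?_
  · induction m using WithOne.recOneCoe with
    | one => simp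
    | coe s => simp [h]
  · obtain ⟨z, s, t, rfl, rfl⟩ := hmk x y hxy
    rw [← permRepresentation_coe_single, ← permRepresentation_coe_single,
      Coinvariants.mk_self_apply, Coinvariants.mk_self_apply]

end

/-- The map `y ↦ σ y`, placed at the generator `τ y`, is equivariant into a free module, and
evaluating generators in `Y` retracts it because `σ y • τ y = y`. -/
theorem projective_permRepresentation {k : Type} [CommRing k] {S Y : Type u} [Semigroup S]
    [SemigroupAction S Y] (σ : Y → S) (τ : Y → Y) (hσ : ∀ (s : S) y, σ (s • y) = s * σ y)
    (hτ : ∀ (s : S) y, τ (s • y) = τ y) (h : ∀ y, σ y • τ y = y) :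
    Projective (Rep.of (permRepresentation k S Y)) := by
  refine Rep.projective_of_free_retract _ (Finsupp.linearCombination k fun y =>
    Finsupp.single (τ y) (MonoidAlgebra.single (σ y : WithOne S) 1)) (fun m v => ?_)
    (fun y => Finsupp.single y 1) fun v => ?_
  · refine withOne_intertwining _ (fun s v => ?_) m v
    induction v using Finsupp.induction_linear with
    | zero => simp
    | add x y hx hy => simp only [map_add, hx, hy]
    | single x r => simp [hσ, hτ]
  · induction v using Finsupp.induction_linear with
    | zero => simp
    | add x y hx hy => simp only [map_add, hx, hy]
    | single x r => simp [h]

/-! ### The projective modules over a Rees matrix semigroup and their coinvariants. -/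

namespace ReesMatrixSemigroup

variable {G : Type u} {A : Type v} {B : Type w} [Group G]

theorem mul_def {C : Matrix B A G} (x y : ReesMatrixSemigroup G A B C) :
    x * y = ⟨x.row, x.val * C x.col y.row * y.val, y.col⟩ := rfl

/-- The set `A × Gⁿ`, on which the Rees matrix semigroup acts from the left. -/
structure RowTuple (C : Matrix B A G) (n : ℕ) : Type (max u v w) where
  /-- the `A`-coordinate -/
  row : A
  /-- the coordinates in the group -/
  tuple : Fin n → G

instance (C : Matrix B A G) (n : ℕ) :
    SemigroupAction (ReesMatrixSemigroup G A B C) (RowTuple C n) where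
  smul s x := ⟨s.row, (s.val * C s.col x.row) • x.tuple⟩
  mul_smul s t x := by
    change RowTuple.mk _ _ = RowTuple.mk _ ((s.val * C s.col t.row) • (t.val * C t.col x.row) •
      x.tuple)
    rw [← mul_smul, ← mul_assoc]
    rfl

theorem RowTuple.smul_def {C : Matrix B A G} {n : ℕ} (s : ReesMatrixSemigroup G A B C)
    (x : RowTuple C n) : s • x = ⟨s.row, (s.val * C s.col x.row) • x.tuple⟩ := rfl

/-- The set `A × G × Ā × B̄`, on which the Rees matrix semigroup acts from the left through the
first two factors. -/
structure RowCell (C : Matrix B A G) (a₀ : A) (b₀ : B) : Type (max u v w) where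
  /-- the `A`-coordinate -/
  row : A
  /-- the group coordinate -/
  val : G
  /-- the coordinate in `Ā × B̄` -/
  cell : {a : A // a ≠ a₀} × {b : B // b ≠ b₀}

instance (C : Matrix B A G) (a₀ : A) (b₀ : B) :
    SemigroupAction (ReesMatrixSemigroup G A B C) (RowCell C a₀ b₀) where
  smul s x := ⟨s.row, s.val * C s.col x.row * x.val, x.cell⟩
  mul_smul s t x := by
    change RowCell.mk _ _ _ = RowCell.mk _ (s.val * C s.col t.row * (t.val * C t.col x.row * x.val))
      _
    simp only [← mul_assoc]
    rfl

variable {C : Matrix B A G} {a₀ : A} {b₀ : B}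

theorem RowCell.smul_def (s : ReesMatrixSemigroup G A B C) (x : RowCell C a₀ b₀) :
    s • x = ⟨s.row, s.val * C s.col x.row * x.val, x.cell⟩ := rfl

variable (k : Type) [CommRing k]

theorem projective_rowTuple (hC : IsNormalized C a₀ b₀) (n : ℕ) :
    Projective (Rep.of (permRepresentation k (ReesMatrixSemigroup G A B C)
      (RowTuple C (n + 1)))) := by
  -- As for groups, the first group coordinate is split off; (row, x₀, b₀) acts on (a₀, x₀⁻¹x)
  -- without a twist since C_{b₀a₀} = 1.
  refine projective_permRepresentation (fun x => ⟨x.row, x.tuple 0, b₀⟩)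
    (fun x => ⟨a₀, (x.tuple 0)⁻¹ • x.tuple⟩) (fun s x => rfl) (fun s x => ?_) fun x => ?_
  · simp only [RowTuple.smul_def, Pi.smul_apply, smul_eq_mul]
    rw [smul_smul]
    congr 1
    group
  · simp [RowTuple.smul_def, hC.1]

theorem projective_rowCell (hC : IsNormalized C a₀ b₀) :
    Projective (Rep.of (permRepresentation k (ReesMatrixSemigroup G A B C)
      (RowCell C a₀ b₀))) := by
  refine projective_permRepresentation (fun x => ⟨x.row, x.val, b₀⟩)
    (fun x => ⟨a₀, 1, x.cell⟩) (fun s x => rfl) (fun s x => rfl) fun x => ?_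
  simp [RowCell.smul_def, hC.1]

theorem isCoinvariants_rowTuple (hC : IsNormalized C a₀ b₀) (n : ℕ) :
    (permRepresentation k (ReesMatrixSemigroup G A B C) (RowTuple C n)).IsCoinvariants
      (Finsupp.lmapDomain k k fun x : RowTuple C n => TupleOrbit.mk x.tuple) := by
  refine isCoinvariants_permRepresentation _ (fun o => ?_) (fun s x => ?_) fun x y h => ?_
  · obtain ⟨x, rfl⟩ := TupleOrbit.mk_surjective o
    exact ⟨⟨a₀, x⟩, rfl⟩
  · simp [RowTuple.smul_def]
  · obtain ⟨g, hg⟩ := TupleOrbit.mk_eq_iff.1 h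
    -- Elements with column b₀ act through their group coordinate alone, and reach every row.
    refine ⟨⟨a₀, y.tuple⟩, ⟨x.row, g, b₀⟩, ⟨y.row, 1, b₀⟩, ?_, ?_⟩
    · simp [RowTuple.smul_def, hC.1, hg]
    · simp [RowTuple.smul_def, hC.1]

theorem isCoinvariants_rowCell (hC : IsNormalized C a₀ b₀) :
    (permRepresentation k (ReesMatrixSemigroup G A B C) (RowCell C a₀ b₀)).IsCoinvariants
      (Finsupp.lmapDomain k k RowCell.cell) := by
  refine isCoinvariants_permRepresentation _ (fun o => ⟨⟨a₀, 1, o⟩, rfl⟩) (fun s x => rfl)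
    fun x y h => ?_
  refine ⟨⟨a₀, 1, x.cell⟩, ⟨x.row, x.val, b₀⟩, ⟨y.row, y.val, b₀⟩, ?_, ?_⟩
  · simp [RowCell.smul_def, hC.1]
  · simp [RowCell.smul_def, hC.1, h]

variable (C a₀ b₀)

/-- The index set of a basis of the direct sum of `Ā` copies of `kS¹(1 - e)`, `e = (a₀, 1, b₀)`:
`(a, none)` stands for `1 - e` and `(a, some (a', g, b))` for `(a', g, b) - (a', g, b₀)` in the
copy with index `a`. -/
abbrev ComplementIndex (_C : Matrix B A G) (a₀ : A) (b₀ : B) : Type (max u v w) :=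
  {a : A // a ≠ a₀} × Option (A × G × {b : B // b ≠ b₀})

open Classical in
/-- The element `(a', g, b) - (a', g, b₀)` in the copy of `kS¹(1 - e)` with index `a`. -/
noncomputable def complementSingle (a : {a : A // a ≠ a₀}) (s : ReesMatrixSemigroup G A B C) :
    ComplementIndex C a₀ b₀ →₀ k :=
  if h : s.col ≠ b₀ then Finsupp.single (a, some (s.row, s.val, ⟨s.col, h⟩)) 1 else 0

variable {C a₀ b₀}

omit [Group G] in
theorem complementSingle_of_ne (a : {a : A // a ≠ a₀}) (a' : A) (g : G) (b : {b : B // b ≠ b₀}) :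
    complementSingle C a₀ b₀ k a ⟨a', g, b⟩ = Finsupp.single (a, some (a', g, b)) 1 := by
  rw [complementSingle, dif_pos b.2]

omit [Group G] in
theorem complementSingle_of_eq (a : {a : A // a ≠ a₀}) (a' : A) (g : G) :
    complementSingle C a₀ b₀ k a ⟨a', g, b₀⟩ = 0 := by
  rw [complementSingle, dif_neg (by simp)]

variable (C a₀ b₀)

/-- The action of the Rees matrix semigroup on `⨁ kS¹(1 - e)`. -/
noncomputable def complementAct (s : ReesMatrixSemigroup G A B C) :
    Module.End k (ComplementIndex C a₀ b₀ →₀ k) :=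
  Finsupp.linearCombination k fun x => match x with
    | (a, none) => complementSingle C a₀ b₀ k a s
    | (a, some (a', g, b)) => Finsupp.single (a, some (s.row, s.val * C s.col a' * g, b)) 1

variable {C a₀ b₀}

@[simp]
theorem complementAct_none (s : ReesMatrixSemigroup G A B C) (a : {a : A // a ≠ a₀}) (r : k) :
    complementAct C a₀ b₀ k s (Finsupp.single (a, none) r) =
      r • complementSingle C a₀ b₀ k a s := by
  simp [complementAct]

@[simp]
theorem complementAct_some (s : ReesMatrixSemigroup G A B C) (a : {a : A // a ≠ a₀})
    (a' : A) (g : G) (b : {b : B // b ≠ b₀}) (r : k) :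
    complementAct C a₀ b₀ k s (Finsupp.single (a, some (a', g, b)) r) =
      Finsupp.single (a, some (s.row, s.val * C s.col a' * g, b)) r := by
  simp [complementAct]

/-- Left multiplication preserves the column, hence also the case in which the difference is zero.
-/
theorem complementAct_complementSingle (s t : ReesMatrixSemigroup G A B C)
    (a : {a : A // a ≠ a₀}) :
    complementAct C a₀ b₀ k s (complementSingle C a₀ b₀ k a t) =
      complementSingle C a₀ b₀ k a (s * t) := by
  obtain ⟨a', g, b⟩ := t
  rcases eq_or_ne b b₀ with rfl | hb
  · rw [complementSingle_of_eq, map_zero, mul_def, complementSingle_of_eq]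
  · rw [complementSingle_of_ne k a a' g ⟨b, hb⟩, complementAct_some, mul_def,
      complementSingle_of_ne k a s.row _ ⟨b, hb⟩]

variable (C a₀ b₀)

/-- The direct sum of copies of `kS¹(1 - e)`, one for each element of `Ā`. -/
noncomputable def complementRepresentation :
    Representation k (WithOne (ReesMatrixSemigroup G A B C)) (ComplementIndex C a₀ b₀ →₀ k) :=
  withOne
    { toFun := complementAct C a₀ b₀ k
      map_mul' s t := by
        refine Finsupp.lhom_ext' fun x => LinearMap.ext_ring ?_
        obtain ⟨a, _ | ⟨a', g, b⟩⟩ := x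
        · simp [complementAct_complementSingle]
        · simp [mul_def, mul_assoc] }

variable {C a₀ b₀}

@[simp]
theorem complementRepresentation_coe (s : ReesMatrixSemigroup G A B C) :
    complementRepresentation C a₀ b₀ k s = complementAct C a₀ b₀ k s :=
  withOne_coe _ _

omit [Group G] in
theorem complement_induction {p : (ComplementIndex C a₀ b₀ →₀ k) → Prop}
    (x : ComplementIndex C a₀ b₀ →₀ k) (zero : p 0) (add : ∀ x y, p x → p y → p (x + y))
    (none : ∀ a r, p (Finsupp.single (a, none) r))
    (some : ∀ a a' g b r, p (Finsupp.single (a, some (a', g, b)) r)) : p x := by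
  induction x using Finsupp.induction_linear with
  | zero => exact zero
  | add x y hx hy => exact add x y hx hy
  | single x r =>
    obtain ⟨a, _ | ⟨a', g, b⟩⟩ := x
    · exact none a r
    · exact some a a' g b r

/-- Since e(1 - e) = 0, the class of the generator 1 - e is zero, and so are the classes of its
translates s(1 - e). -/
theorem mk_complementRepresentation (x : ComplementIndex C a₀ b₀ →₀ k) :
    Coinvariants.mk (complementRepresentation C a₀ b₀ k) x = 0 := by
  have key (a s r) : Coinvariants.mk (complementRepresentation C a₀ b₀ k)
      (Finsupp.single (a, none) r) = Coinvariants.mk _ (r • complementSingle C a₀ b₀ k a s) := by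
    rw [← complementAct_none, ← complementRepresentation_coe, Coinvariants.mk_self_apply]
  induction x using complement_induction with
  | zero => simp
  | add x y hx hy => rw [map_add, hx, hy, add_zero]
  | none a r => rw [key a ⟨a₀, 1, b₀⟩, complementSingle_of_eq, smul_zero, map_zero]
  | some a a' g b r =>
    rw [Finsupp.eq_smul_single_one, ← complementSingle_of_ne, ← key, key a ⟨a₀, 1, b₀⟩,
      complementSingle_of_eq, smul_zero, map_zero]

theorem projective_complement (hC : IsNormalized C a₀ b₀) :
    Projective (Rep.of (complementRepresentation C a₀ b₀ k)) := by
  let M := WithOne (ReesMatrixSemigroup G A B C)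
  let el (s : ReesMatrixSemigroup G A B C) : MonoidAlgebra k M :=
    MonoidAlgebra.single (s : M) 1 -
      MonoidAlgebra.single ((⟨s.row, s.val, b₀⟩ : ReesMatrixSemigroup G A B C) : M) 1
  let i : (ComplementIndex C a₀ b₀ →₀ k) →ₗ[k]
      (ComplementIndex C a₀ b₀ →₀ MonoidAlgebra k M) :=
    Finsupp.linearCombination k fun x => match x with
      | (a, none) => Finsupp.single (a, none)
        (MonoidAlgebra.single 1 1 -
          MonoidAlgebra.single ((⟨a₀, 1, b₀⟩ : ReesMatrixSemigroup G A B C) : M) 1)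
      | (a, some (a', g, b)) => Finsupp.single (a, none) (el ⟨a', g, b⟩)
  have i_none (a r) : i (Finsupp.single (a, none) r) = r • Finsupp.single (a, none)
        (MonoidAlgebra.single 1 1 -
          MonoidAlgebra.single ((⟨a₀, 1, b₀⟩ : ReesMatrixSemigroup G A B C) : M) 1) := by
    simp only [i, Finsupp.linearCombination_single]
  have i_some (a a' g b r) : i (Finsupp.single (a, some (a', g, b)) r) =
      r • Finsupp.single (a, none) (el ⟨a', g, b⟩) := by
    simp only [i, Finsupp.linearCombination_single]
  have hi (a) (s : ReesMatrixSemigroup G A B C) :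
      i (complementSingle C a₀ b₀ k a s) = Finsupp.single (a, none) (el s) := by
    obtain ⟨a', g, b⟩ := s
    rcases eq_or_ne b b₀ with rfl | hb
    · rw [complementSingle_of_eq]
      simp [el]
    · rw [complementSingle_of_ne k a a' g ⟨b, hb⟩, i_some, one_smul]
  -- This realizes kS¹(1 - e) inside kS¹. Only the generators `(a, none)` of the free module meet
  -- the image of `i`; indexing by all of `ComplementIndex` keeps the index type in the required
  -- universe.
  refine Rep.projective_of_free_retract _ i (fun m v => ?_) (fun x => Finsupp.single x 1)
    fun v => ?_
  · refine withOne_intertwining _ (fun s v => ?_) m v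
    induction v using complement_induction with
    | zero => simp
    | add x y hx hy => simp only [map_add, hx, hy]
    | none a r =>
      -- The column a₀ of the matrix being trivial, se is s with its column replaced by b₀.
      rw [complementRepresentation_coe, complementAct_none, map_smul, hi, i_none, map_smul]
      simp [el, ← WithOne.coe_mul, mul_def, hC.2]
    | some a a' g b r =>
      rw [complementRepresentation_coe, complementAct_some, i_some, i_some, map_smul]
      simp [el, ← WithOne.coe_mul, mul_def]
  · induction v using complement_induction with
    | zero => simp
    | add x y hx hy => simp only [map_add, hx, hy]
    | none a r => simp [i_none, map_sub, complementSingle_of_eq]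
    | some a a' g b r =>
      simp [i_some, el, map_sub, complementSingle_of_eq, complementSingle_of_ne]

end ReesMatrixSemigroup

theorem Rep.projective_prod {k : Type} [CommRing k] {M V W : Type u} [Monoid M] [AddCommGroup V]
    [Module k V] [AddCommGroup W] [Module k W] {ρ : Representation k M V}
    {τ : Representation k M W} (hρ : Projective (Rep.of ρ)) (hτ : Projective (Rep.of τ)) :
    Projective (Rep.of (ρ.prod τ)) := by
  refine ⟨fun {E X} f e he => ?_⟩
  let i : Rep.of ρ ⟶ Rep.of (ρ.prod τ) := Rep.ofHom ⟨LinearMap.inl k V W, fun m => by ext <;> simp⟩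
  let j : Rep.of τ ⟶ Rep.of (ρ.prod τ) := Rep.ofHom ⟨LinearMap.inr k V W, fun m => by ext <;> simp⟩
  let p : Rep.of (ρ.prod τ) ⟶ Rep.of ρ := Rep.ofHom ⟨LinearMap.fst k V W, fun m => by ext <;> simp⟩
  let q : Rep.of (ρ.prod τ) ⟶ Rep.of τ := Rep.ofHom ⟨LinearMap.snd k V W, fun m => by ext <;> simp⟩
  refine ⟨p ≫ Projective.factorThru (i ≫ f) e + q ≫ Projective.factorThru (j ≫ f) e, ?_⟩
  rw [Preadditive.add_comp, Category.assoc, Category.assoc, Projective.factorThru_comp,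
    Projective.factorThru_comp, ← Category.assoc, ← Category.assoc, ← Preadditive.add_comp]
  have : p ≫ i + q ≫ j = 𝟙 _ := by
    refine Rep.hom_ext <| IntertwiningMap.ext <| LinearMap.ext fun x => ?_
    change (LinearMap.inl k V W x.1 + LinearMap.inr k V W x.2 : V × W) = x
    simp
  rw [this, Category.id_comp]

/-! ### The resolution of the trivial module and its exactness. -/

namespace ReesMatrixSemigroup

variable {G : Type u} {A : Type v} {B : Type w} [Group G] {C : Matrix B A G} {a₀ : A} {b₀ : B}
  (k : Type) [CommRing k]

variable (C)

/-- The inclusion of `k[Gⁿ]` as the fibre of `k[A × Gⁿ]` over `a`. -/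
noncomputable def fibre (a : A) (n : ℕ) : ((Fin n → G) →₀ k) →ₗ[k] (RowTuple C n →₀ k) :=
  Finsupp.lmapDomain k k fun x => ⟨a, x⟩

variable {C} {k}

omit [Group G] in
@[simp]
theorem fibre_single (a : A) (n : ℕ) (x : Fin n → G) (r : k) :
    fibre C k a n (Finsupp.single x r) = Finsupp.single ⟨a, x⟩ r :=
  Finsupp.mapDomain_single

omit [Group G] in
theorem fibre_induction {n : ℕ} {p : (RowTuple C n →₀ k) → Prop} (x)
    (zero : p 0) (add : ∀ x y, p x → p y → p (x + y)) (fib : ∀ a y, p (fibre C k a n y)) :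
    p x := by
  induction x using Finsupp.induction_linear with
  | zero => exact zero
  | add x y hx hy => exact add x y hx hy
  | single x r => simpa using fib x.row (Finsupp.single x.tuple r)

theorem smul_fibre (s : ReesMatrixSemigroup G A B C) (a : A) (n : ℕ) (y : (Fin n → G) →₀ k) :
    permRepresentation k (ReesMatrixSemigroup G A B C) _ s (fibre C k a n y) =
      fibre C k s.row n (tupleSMul k (s.val * C s.col a) n y) := by
  induction y using Finsupp.induction_linear with
  | zero => simp
  | add x y hx hy => simp only [map_add, hx, hy]
  | single x r => simp [RowTuple.smul_def]

variable (C k)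

/-- The differential `k[A × Gⁿ⁺¹] → k[A × Gⁿ]`. -/
noncomputable def rowD (n : ℕ) : (RowTuple C (n + 1) →₀ k) →ₗ[k] (RowTuple C n →₀ k) :=
  Finsupp.linearCombination k fun x =>
    fibre C k x.row n (tupleD k G n (Finsupp.single x.tuple 1))

/-- The contraction `k[A × Gⁿ] → k[A × Gⁿ⁺¹]`. -/
noncomputable def rowCons (n : ℕ) : (RowTuple C n →₀ k) →ₗ[k] (RowTuple C (n + 1) →₀ k) :=
  Finsupp.lmapDomain k k fun x => ⟨x.row, Fin.cons 1 x.tuple⟩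

variable {C k}

omit [Group G] in
@[simp]
theorem rowD_fibre (n : ℕ) (a : A) (y : (Fin (n + 1) → G) →₀ k) :
    rowD C k n (fibre C k a (n + 1) y) = fibre C k a n (tupleD k G n y) := by
  induction y using Finsupp.induction_linear with
  | zero => simp
  | add x y hx hy => simp only [map_add, hx, hy]
  | single x r =>
    rw [Finsupp.eq_smul_single_one, map_smul, map_smul, map_smul, map_smul, fibre_single, rowD,
      Finsupp.linearCombination_single, one_smul]

@[simp]
theorem rowCons_fibre (n : ℕ) (a : A) (y : (Fin n → G) →₀ k) :
    rowCons C k n (fibre C k a n y) = fibre C k a (n + 1) (tupleCons k 1 n y) := by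
  induction y using Finsupp.induction_linear with
  | zero => simp
  | add x y hx hy => simp only [map_add, hx, hy]
  | single x r => simp [rowCons]

omit [Group G] in
theorem rowD_rowD (n : ℕ) (x : RowTuple C (n + 2) →₀ k) :
    rowD C k n (rowD C k (n + 1) x) = 0 := by
  induction x using fibre_induction with
  | zero => simp
  | add x y hx hy => rw [map_add, map_add, hx, hy, add_zero]
  | fib a y => simp [tupleD_tupleD]

/-- The contraction of the group complex works in each fibre over A separately. It is only linear:
prefixing 1 does not commute with the action. -/
theorem rowD_rowCons_succ (n : ℕ) (x : RowTuple C (n + 1) →₀ k) :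
    rowD C k (n + 1) (rowCons C k (n + 1) x) = x - rowCons C k n (rowD C k n x) := by
  induction x using fibre_induction with
  | zero => simp
  | add x y hx hy => simp only [map_add, hx, hy]; abel
  | fib a y => simp [tupleD_succ_cons]

theorem exists_rowD_eq (n : ℕ) (x : RowTuple C (n + 1) →₀ k) (hx : rowD C k n x = 0) :
    ∃ y, rowD C k (n + 1) y = x :=
  ⟨rowCons C k (n + 1) x, by rw [rowD_rowCons_succ, hx, map_zero, sub_zero]⟩

theorem rowD_intertwining (n : ℕ) (m : WithOne (ReesMatrixSemigroup G A B C))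
    (x : RowTuple C (n + 1) →₀ k) :
    rowD C k n (permRepresentation k _ _ m x) = permRepresentation k _ _ m (rowD C k n x) := by
  refine withOne_intertwining _ (fun s x => ?_) m x
  induction x using fibre_induction with
  | zero => simp
  | add x y hx hy => simp only [map_add, hx, hy]
  | fib a y => simp [smul_fibre, tupleD_smul]

/-- The differential is compatible with the projections to orbits. -/
theorem orbitD_lmapDomain (n : ℕ) (x : RowTuple C (n + 1) →₀ k) :
    orbitD k G n (Finsupp.lmapDomain k k (fun x : RowTuple C (n + 1) => TupleOrbit.mk x.tuple) x) =
      Finsupp.lmapDomain k k (fun x : RowTuple C n => TupleOrbit.mk x.tuple) (rowD C k n x) := by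
  have h (n : ℕ) (a : A) (y : (Fin n → G) →₀ k) : Finsupp.lmapDomain k k
      (fun x : RowTuple C n => TupleOrbit.mk x.tuple) (fibre C k a n y) = tupleProj k G n y := by
    induction y using Finsupp.induction_linear with
    | zero => simp
    | add x y hx hy => simp only [map_add, hx, hy]
    | single x r => simp
  induction x using fibre_induction with
  | zero => simp
  | add x y hx hy => simp only [map_add, hx, hy]
  | fib a y => rw [h, rowD_fibre, h, orbitD_proj]

variable (C a₀ b₀ k)

/-- The map `k[A × G × Ā × B̄] → k[A × G²]`,
`(a', g, (a, b)) ↦ (a', (g, g C_{ba}))`. -/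
noncomputable def cellToTuple : (RowCell C a₀ b₀ →₀ k) →ₗ[k] (RowTuple C 2 →₀ k) :=
  Finsupp.lmapDomain k k fun x => ⟨x.row, ![x.val, x.val * C x.cell.2 x.cell.1]⟩

/-- The map from `k[A × G × Ā × B̄]` to copies of `kS¹(1 - e)`. -/
noncomputable def cellToComplement :
    (RowCell C a₀ b₀ →₀ k) →ₗ[k] (ComplementIndex C a₀ b₀ →₀ k) :=
  Finsupp.lmapDomain k k fun x => (x.cell.1, some (x.row, x.val, x.cell.2))

/-- The map from copies of `kS¹(1 - e)` to `k[A × G]` that sends `1 - e` in the copy with index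
`a` to `(a, 1) - (a₀, 1)`. -/
noncomputable def complementToTuple :
    (ComplementIndex C a₀ b₀ →₀ k) →ₗ[k] (RowTuple C 1 →₀ k) :=
  Finsupp.linearCombination k fun x => match x with
    | (a, none) => Finsupp.single ⟨a, ![1]⟩ 1 - Finsupp.single ⟨a₀, ![1]⟩ 1
    | (a, some (a', g, b)) =>
      Finsupp.single ⟨a', ![g * C b a]⟩ 1 - Finsupp.single ⟨a', ![g]⟩ 1

variable {C a₀ b₀ k}

@[simp]
theorem cellToTuple_single (x : RowCell C a₀ b₀) (r : k) :
    cellToTuple C a₀ b₀ k (Finsupp.single x r) =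
      Finsupp.single ⟨x.row, ![x.val, x.val * C x.cell.2 x.cell.1]⟩ r :=
  Finsupp.mapDomain_single

omit [Group G] in
@[simp]
theorem cellToComplement_single (x : RowCell C a₀ b₀) (r : k) :
    cellToComplement C a₀ b₀ k (Finsupp.single x r) =
      Finsupp.single (x.cell.1, some (x.row, x.val, x.cell.2)) r :=
  Finsupp.mapDomain_single

@[simp]
theorem complementToTuple_none (a : {a : A // a ≠ a₀}) (r : k) :
    complementToTuple C a₀ b₀ k (Finsupp.single (a, none) r) =
      Finsupp.single ⟨a, ![1]⟩ r - Finsupp.single ⟨a₀, ![1]⟩ r := by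
  simp [complementToTuple, smul_sub]

@[simp]
theorem complementToTuple_some (a : {a : A // a ≠ a₀}) (a' : A) (g : G) (b : {b : B // b ≠ b₀})
    (r : k) : complementToTuple C a₀ b₀ k (Finsupp.single (a, some (a', g, b)) r) =
      Finsupp.single ⟨a', ![g * C b a]⟩ r - Finsupp.single ⟨a', ![g]⟩ r := by
  simp [complementToTuple, smul_sub]

omit [Group G] in
theorem cellToComplement_injective : Function.Injective (cellToComplement C a₀ b₀ k) := by
  refine Finsupp.mapDomain_injective fun x y h => ?_
  obtain ⟨a, g, ⟨c, d⟩⟩ := x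
  obtain ⟨a', g', ⟨c', d'⟩⟩ := y
  simp_all

theorem complementToTuple_complementSingle (hC : IsNormalized C a₀ b₀) (a : {a : A // a ≠ a₀})
    (s : ReesMatrixSemigroup G A B C) :
    complementToTuple C a₀ b₀ k (complementSingle C a₀ b₀ k a s) =
      Finsupp.single ⟨s.row, ![s.val * C s.col a]⟩ 1 - Finsupp.single ⟨s.row, ![s.val]⟩ 1 := by
  obtain ⟨a', g, b⟩ := s
  rcases eq_or_ne b b₀ with rfl | hb
  · rw [complementSingle_of_eq, map_zero]
    simp [hC.1]
  · rw [complementSingle_of_ne k a a' g ⟨b, hb⟩, complementToTuple_some]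

/-- Applying s to (a, 1) - (a₀, 1) gives the difference of s.val · C_{s.col,a} and s.val in row
`s.row`; the second entry is untwisted since C_{s.col,a₀} = 1. -/
theorem complementToTuple_intertwining (hC : IsNormalized C a₀ b₀)
    (m : WithOne (ReesMatrixSemigroup G A B C)) (x : ComplementIndex C a₀ b₀ →₀ k) :
    complementToTuple C a₀ b₀ k (complementRepresentation C a₀ b₀ k m x) =
      permRepresentation k _ _ m (complementToTuple C a₀ b₀ k x) := by
  refine withOne_intertwining _ (fun s x => ?_) m x
  induction x using complement_induction with
  | zero => simp
  | add x y hx hy => simp only [map_add, hx, hy]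
  | none a r =>
    rw [complementRepresentation_coe, complementAct_none, map_smul,
      complementToTuple_complementSingle hC]
    simp [RowTuple.smul_def, hC.2, smul_sub]
  | some a a' g b r => simp [RowTuple.smul_def, mul_assoc]

theorem cellToComplement_intertwining (m : WithOne (ReesMatrixSemigroup G A B C))
    (x : RowCell C a₀ b₀ →₀ k) :
    cellToComplement C a₀ b₀ k (permRepresentation k _ _ m x) =
      complementRepresentation C a₀ b₀ k m (cellToComplement C a₀ b₀ k x) := by
  refine withOne_intertwining _ (fun s x => ?_) m x
  induction x using Finsupp.induction_linear with
  | zero => simp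
  | add x y hx hy => simp only [map_add, hx, hy]
  | single x r => simp [RowCell.smul_def]

theorem cellToTuple_intertwining (m : WithOne (ReesMatrixSemigroup G A B C))
    (x : RowCell C a₀ b₀ →₀ k) :
    cellToTuple C a₀ b₀ k (permRepresentation k _ _ m x) =
      permRepresentation k _ _ m (cellToTuple C a₀ b₀ k x) := by
  refine withOne_intertwining _ (fun s x => ?_) m x
  induction x using Finsupp.induction_linear with
  | zero => simp
  | add x y hx hy => simp only [map_add, hx, hy]
  | single x r => simp [RowCell.smul_def, RowTuple.smul_def, mul_assoc]

omit [Group G] in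
theorem rowD_single_one (a : A) (g : G) (r : k) :
    rowD C k 0 (Finsupp.single ⟨a, ![g]⟩ r) = Finsupp.single ⟨a, ![]⟩ r := by
  have h : Finsupp.single ⟨a, ![g]⟩ r = fibre C k a 1 (tupleCons k g 0 (Finsupp.single ![] r)) := by
    simp
  rw [h, rowD_fibre, tupleD_zero_cons, fibre_single]

omit [Group G] in
theorem rowD_single_pair (a : A) (g h : G) (r : k) :
    rowD C k 1 (Finsupp.single ⟨a, ![g, h]⟩ r) =
      Finsupp.single ⟨a, ![h]⟩ r - Finsupp.single ⟨a, ![g]⟩ r := by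
  have e : Finsupp.single ⟨a, ![g, h]⟩ r =
      fibre C k a 2 (tupleCons k g 1 (tupleCons k h 0 (Finsupp.single ![] r))) := by
    simp
  rw [e, rowD_fibre, tupleD_succ_cons, tupleD_zero_cons]
  simp

/-- The two maps out of the cells form a chain map of resolutions lifting the inclusion of ker(k[A]
→ k) in k[A]. -/
theorem rowD_cellToTuple (x : RowCell C a₀ b₀ →₀ k) :
    rowD C k 1 (cellToTuple C a₀ b₀ k x) =
      complementToTuple C a₀ b₀ k (cellToComplement C a₀ b₀ k x) := by
  induction x using Finsupp.induction_linear with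
  | zero => simp
  | add x y hx hy => simp only [map_add, hx, hy]
  | single x r => simp [rowD_single_pair]

variable (C k) in
/-- The sum of the coefficients. -/
noncomputable def coeffSum (n : ℕ) : (RowTuple C n →₀ k) →ₗ[k] k :=
  Finsupp.linearCombination k fun _ => 1

omit [Group G] in
@[simp]
theorem coeffSum_single (n : ℕ) (x : RowTuple C n) (r : k) :
    coeffSum C k n (Finsupp.single x r) = r := by
  simp [coeffSum]

omit [Group G] in
theorem coeffSum_rowD_zero (x : RowTuple C 1 →₀ k) :
    coeffSum C k 0 (rowD C k 0 x) = coeffSum C k 1 x := by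
  induction x using Finsupp.induction_linear with
  | zero => simp
  | add x y hx hy => simp only [map_add, hx, hy]
  | single x r =>
    obtain ⟨a, t⟩ := x
    obtain ⟨g, rfl⟩ : ∃ g, t = ![g] := ⟨t 0, by ext i; simp [Subsingleton.elim i 0]⟩
    rw [rowD_single_one, coeffSum_single, coeffSum_single]

omit [Group G] in
theorem coeffSum_rowD_one (x : RowTuple C 2 →₀ k) : coeffSum C k 1 (rowD C k 1 x) = 0 := by
  rw [← coeffSum_rowD_zero, rowD_rowD, map_zero]

theorem coeffSum_complementToTuple (x : ComplementIndex C a₀ b₀ →₀ k) :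
    coeffSum C k 1 (complementToTuple C a₀ b₀ k x) = 0 := by
  induction x using complement_induction with
  | zero => simp
  | add x y hx hy => rw [map_add, map_add, hx, hy, add_zero]
  | none a r => simp
  | some a a' g b r => simp

theorem coeffSum_intertwining (n : ℕ) (m : WithOne (ReesMatrixSemigroup G A B C))
    (x : RowTuple C n →₀ k) : coeffSum C k n (permRepresentation k _ _ m x) = coeffSum C k n x := by
  refine withOne_intertwining (τ := Representation.trivial k _ k) _ (fun s x => ?_) m x
  induction x using Finsupp.induction_linear with
  | zero => simp
  | add x y hx hy => simp only [map_add, hx, hy]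
  | single x r => simp

/-- In k[A] the generator of copy a becomes a - a₀ and the other basis elements die, so the
coefficient at a ≠ a₀ recovers that of 1 - e. -/
theorem rowD_complementToTuple_apply (x : ComplementIndex C a₀ b₀ →₀ k) (a : {a : A // a ≠ a₀}) :
    rowD C k 0 (complementToTuple C a₀ b₀ k x) ⟨a, ![]⟩ = x (a, none) := by
  classical
  induction x using complement_induction with
  | zero => simp
  | add x y hx hy => simp only [map_add, Finsupp.add_apply, hx, hy]
  | none a' r =>
    have := a.2.symm
    simp [rowD_single_one, Finsupp.single_apply, Subtype.ext_iff, this]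
  | some a a' g b r => simp [rowD_single_one]

omit [Group G] in
theorem exists_cellToComplement_eq (x : ComplementIndex C a₀ b₀ →₀ k)
    (hx : ∀ a, x (a, none) = 0) : ∃ y, cellToComplement C a₀ b₀ k y = x := by
  refine (Finsupp.mem_range_mapDomain_iff _ (fun x y h => ?_) x).2 fun y hy => ?_
  · obtain ⟨a, g, ⟨c, d⟩⟩ := x
    obtain ⟨a', g', ⟨c', d'⟩⟩ := y
    simp_all
  · obtain ⟨a, _ | ⟨a', g, b⟩⟩ := y
    · exact hx a
    · exact absurd ⟨⟨a', g, a, b⟩, rfl⟩ hy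

theorem exact_tuple_zero (x : RowTuple C 1 →₀ k) (hx : coeffSum C k 1 x = 0) :
    ∃ (y : RowTuple C 2 →₀ k) (z : ComplementIndex C a₀ b₀ →₀ k),
      rowD C k 1 y + complementToTuple C a₀ b₀ k z = x := by
  classical
  -- `L` lifts a - a₀ to 1 - e in copy a. It corrects `x` to an element that vanishes in k[A], where
  -- the induced complex is exact.
  let L : (RowTuple C 0 →₀ k) →ₗ[k] (ComplementIndex C a₀ b₀ →₀ k) :=
    Finsupp.linearCombination k fun x =>
      if h : x.row ≠ a₀ then Finsupp.single (⟨x.row, h⟩, none) 1 else 0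
  have hL (z : RowTuple C 0 →₀ k) : rowD C k 0 (complementToTuple C a₀ b₀ k (L z)) =
      z - Finsupp.single ⟨a₀, ![]⟩ (coeffSum C k 0 z) := by
    induction z using Finsupp.induction_linear with
    | zero => simp
    | add x y hx hy => simp only [map_add, hx, hy, Finsupp.single_add]; abel
    | single z r =>
      obtain ⟨a, t⟩ := z
      obtain rfl : t = ![] := Subsingleton.elim _ _
      by_cases h : a = a₀
      · simp [L, h]
      · simp [L, h, rowD_single_one]
  have h0 : rowD C k 0 (x - complementToTuple C a₀ b₀ k (L (rowD C k 0 x))) = 0 := by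
    rw [map_sub, hL, coeffSum_rowD_zero, hx, Finsupp.single_zero, sub_zero, sub_self]
  obtain ⟨y, hy⟩ := exists_rowD_eq 0 _ h0
  exact ⟨y, L (rowD C k 0 x), by rw [hy, sub_add_cancel]⟩

theorem exact_tuple_one (x : RowTuple C 2 →₀ k) (z : ComplementIndex C a₀ b₀ →₀ k)
    (h : rowD C k 1 x + complementToTuple C a₀ b₀ k z = 0) :
    ∃ (y : RowTuple C 3 →₀ k) (c : RowCell C a₀ b₀ →₀ k),
      rowD C k 2 y + cellToTuple C a₀ b₀ k c = x ∧ -cellToComplement C a₀ b₀ k c = z := by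
  have h0 : rowD C k 0 (complementToTuple C a₀ b₀ k z) = 0 := by
    simpa [rowD_rowD] using congr(rowD C k 0 $h)
  -- A degree-1 cycle has no 1 - e components, so its complement part comes from cells; subtracting
  -- their boundary leaves a cycle of the induced complex.
  obtain ⟨c, rfl⟩ := exists_cellToComplement_eq z fun a => by
    rw [← rowD_complementToTuple_apply, h0, Finsupp.zero_apply]
  rw [← rowD_cellToTuple, ← map_add] at h
  obtain ⟨y, hy⟩ := exists_rowD_eq 1 _ h
  exact ⟨y, -c, by rw [hy, map_neg, add_neg_cancel_right], by rw [map_neg, neg_neg]⟩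

theorem exact_tuple_two (x : RowTuple C 3 →₀ k) (c : RowCell C a₀ b₀ →₀ k)
    (h1 : rowD C k 2 x + cellToTuple C a₀ b₀ k c = 0) (h2 : -cellToComplement C a₀ b₀ k c = 0) :
    c = 0 ∧ ∃ y, rowD C k 3 y = x := by
  obtain rfl : c = 0 := cellToComplement_injective (by simpa using h2)
  rw [map_zero, add_zero] at h1
  exact ⟨rfl, exists_rowD_eq 2 x h1⟩

variable (C a₀ b₀ k)

/-- The terms of the resolution of the trivial module. -/
noncomputable def resolutionX : ℕ → Rep.{max u v w} k (WithOne (ReesMatrixSemigroup G A B C))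
  | 0 => Rep.of (permRepresentation k (ReesMatrixSemigroup G A B C) (RowTuple C 1))
  | 1 => Rep.of ((permRepresentation k (ReesMatrixSemigroup G A B C) (RowTuple C 2)).prod
      (complementRepresentation C a₀ b₀ k))
  | 2 => Rep.of ((permRepresentation k (ReesMatrixSemigroup G A B C) (RowTuple C 3)).prod
      (permRepresentation k (ReesMatrixSemigroup G A B C) (RowCell C a₀ b₀)))
  | n + 3 => Rep.of (permRepresentation k (ReesMatrixSemigroup G A B C) (RowTuple C (n + 4)))

variable {C a₀ b₀}

/-- The differentials of the resolution of the trivial module. -/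
noncomputable def resolutionD (hC : IsNormalized C a₀ b₀) :
    ∀ n, resolutionX C a₀ b₀ k (n + 1) ⟶ resolutionX C a₀ b₀ k n
  | 0 => Rep.ofHom (LinearMap.intertwiningMap_of_isIntertwiningMap _ _
      ((rowD C k 1).coprod (complementToTuple C a₀ b₀ k)) fun m x => by
        simp [rowD_intertwining, complementToTuple_intertwining hC])
  -- The minus sign is that of the mapping cone.
  | 1 => Rep.ofHom (LinearMap.intertwiningMap_of_isIntertwiningMap _ _
      (((rowD C k 2).coprod (cellToTuple C a₀ b₀ k)).prod
        (-(cellToComplement C a₀ b₀ k) ∘ₗ LinearMap.snd k _ _)) fun m x => by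
        simp [rowD_intertwining, cellToTuple_intertwining, cellToComplement_intertwining])
  | 2 => Rep.ofHom (LinearMap.intertwiningMap_of_isIntertwiningMap _ _
      (LinearMap.inl k _ _ ∘ₗ rowD C k 3) fun m x => by simp [rowD_intertwining])
  | n + 3 => Rep.ofHom (LinearMap.intertwiningMap_of_isIntertwiningMap _ _
      (rowD C k (n + 4)) fun m x => by simp [rowD_intertwining])

/-- The resolution of the trivial module of a Rees matrix semigroup with identity adjoined. -/
noncomputable def resolution (hC : IsNormalized C a₀ b₀) :
    ElementwiseResolution (Rep.trivial k (WithOne (ReesMatrixSemigroup G A B C))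
      (ULift.{max u v w} k)) where
  X := resolutionX C a₀ b₀ k
  d := resolutionD k hC
  ε := Rep.ofHom (LinearMap.intertwiningMap_of_isIntertwiningMap _ _
      (ULift.moduleEquiv.symm.toLinearMap ∘ₗ coeffSum C k 1) fun m x => by
        simp [coeffSum_intertwining])
  projective
    | 0 => projective_rowTuple k hC 0
    | 1 => Rep.projective_prod (projective_rowTuple k hC 1) (projective_complement k hC)
    | 2 => Rep.projective_prod (projective_rowTuple k hC 2) (projective_rowCell k hC)
    | n + 3 => projective_rowTuple k hC (n + 3)
  d_d
    | 0 => fun x => by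
      change rowD C k 1 (rowD C k 2 x.1 + cellToTuple C a₀ b₀ k x.2) +
        complementToTuple C a₀ b₀ k (-cellToComplement C a₀ b₀ k x.2) = 0
      rw [map_add, rowD_rowD, rowD_cellToTuple, map_neg, zero_add, add_neg_cancel]
    | 1 => fun x => Prod.ext
        (congr($(rowD_rowD 2 x) + $(map_zero (cellToTuple C a₀ b₀ k))).trans (add_zero 0))
        (congr(-$(map_zero (cellToComplement C a₀ b₀ k))).trans neg_zero)
    | 2 => fun x => Prod.ext (rowD_rowD 3 x) rfl
    | n + 3 => rowD_rowD (n + 4)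
  ε_d x := by
    change ULift.up (coeffSum C k 1 (rowD C k 1 x.1 + complementToTuple C a₀ b₀ k x.2)) = 0
    rw [map_add, coeffSum_rowD_one, coeffSum_complementToTuple, add_zero]
    rfl
  ε_surjective := fun (r : ULift.{max u v w} k) =>
    ⟨Finsupp.single ⟨a₀, ![1]⟩ r.down, congr_arg ULift.up (coeffSum_single ..)⟩
  exact_zero x hx := by
    obtain ⟨y, z, h⟩ := exact_tuple_zero (a₀ := a₀) (b₀ := b₀) x (congr_arg ULift.down hx)
    exact ⟨(y, z), h⟩
  exact_succ
    | 0 => fun x hx => by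
      obtain ⟨y, c, h⟩ := exact_tuple_one x.1 x.2 hx
      exact ⟨(y, c), Prod.ext h.1 h.2⟩
    | 1 => fun x hx => by
      obtain ⟨h, y, hy⟩ := exact_tuple_two x.1 x.2 (congr_arg Prod.fst hx) (congr_arg Prod.snd hx)
      exact ⟨y, Prod.ext hy h.symm⟩
    | 2 => fun x hx => exists_rowD_eq 3 x (congr_arg Prod.fst hx)
    | n + 3 => fun x hx => exists_rowD_eq (n + 4) x hx

end ReesMatrixSemigroup

/-! ### The complex of coinvariants: the group complex with extra 2-cells. -/

namespace ReesMatrixSemigroup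

variable {G : Type u} {A : Type v} {B : Type w} [Group G] (C : Matrix B A G) (a₀ : A) (b₀ : B)
  (k : Type) [CommRing k]

/-- The map `k[Ā × B̄] → k[G²/G]` that sends `(a, b)` to the orbit of `(1, C_{ba})`. -/
noncomputable def cellBoundary :
    ({a : A // a ≠ a₀} × {b : B // b ≠ b₀} →₀ k) →ₗ[k] (TupleOrbit G 2 →₀ k) :=
  Finsupp.lmapDomain k k fun p => TupleOrbit.mk ![1, C p.2 p.1]

/-- The differential `k[G³/G] ⊕ k[Ā × B̄] → k[G²/G]`. -/
noncomputable def orbitCellD :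
    ((TupleOrbit G 3 →₀ k) × ({a : A // a ≠ a₀} × {b : B // b ≠ b₀} →₀ k)) →ₗ[k]
      (TupleOrbit G 2 →₀ k) :=
  (orbitD k G 2).coprod (cellBoundary C a₀ b₀ k)

variable {C a₀ b₀ k}

theorem lmapDomain_cellToTuple (x : RowCell C a₀ b₀ →₀ k) :
    Finsupp.lmapDomain k k (fun x : RowTuple C 2 => TupleOrbit.mk x.tuple)
      (cellToTuple C a₀ b₀ k x) =
    cellBoundary C a₀ b₀ k (Finsupp.lmapDomain k k RowCell.cell x) := by
  induction x using Finsupp.induction_linear with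
  | zero => simp
  | add x y hx hy => simp only [map_add, hx, hy]
  | single x r =>
    simp only [cellToTuple_single, Finsupp.lmapDomain_apply, Finsupp.mapDomain_single,
      cellBoundary]
    congr 1
    refine TupleOrbit.mk_eq_iff.2 ⟨x.val, ?_⟩
    ext i
    fin_cases i <;> simp

/-- All 1-tuples lie in one orbit, so differences of them vanish. -/
theorem lmapDomain_complementToTuple (x : ComplementIndex C a₀ b₀ →₀ k) :
    Finsupp.lmapDomain k k (fun x : RowTuple C 1 => TupleOrbit.mk x.tuple)
      (complementToTuple C a₀ b₀ k x) = 0 := by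
  have h (g h : G) : TupleOrbit.mk ![g] = TupleOrbit.mk ![h] :=
    TupleOrbit.mk_eq_iff.2 ⟨g * h⁻¹, by ext i; simp [Subsingleton.elim i 0]⟩
  induction x using complement_induction with
  | zero => simp
  | add x y hx hy => rw [map_add, map_add, hx, hy, add_zero]
  | none a r =>
    rw [complementToTuple_none, map_sub, sub_eq_zero]
    simp
  | some a a' g b r =>
    rw [complementToTuple_some, map_sub, sub_eq_zero]
    simp [h _ g]

theorem lmapDomain_inl_rowD (x : RowTuple C 4 →₀ k) :
    (Finsupp.lmapDomain k k (fun x : RowTuple C 3 => TupleOrbit.mk x.tuple)).prodMap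
        (Finsupp.lmapDomain k k RowCell.cell) (rowD C k 3 x, (0 : RowCell C a₀ b₀ →₀ k)) =
      LinearMap.inl k _ _ (orbitD k G 3
        (Finsupp.lmapDomain k k (fun x : RowTuple C 4 => TupleOrbit.mk x.tuple) x)) :=
  Prod.ext (orbitD_lmapDomain 3 x).symm 
    (Finsupp.lmapDomain k k (RowCell.cell : RowCell C a₀ b₀ → _)).map_zero

theorem isCoinvariants_resolution_one (hC : IsNormalized C a₀ b₀) :
    ((permRepresentation k (ReesMatrixSemigroup G A B C) (RowTuple C 2)).prod
      (complementRepresentation C a₀ b₀ k)).IsCoinvariants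
      (Finsupp.lmapDomain k k (fun x : RowTuple C 2 => TupleOrbit.mk x.tuple) ∘ₗ
        LinearMap.fst k _ _) :=
  (isCoinvariants_rowTuple k hC 2).comp_fst (mk_complementRepresentation k)

theorem isCoinvariants_resolution_two (hC : IsNormalized C a₀ b₀) :
    ((permRepresentation k (ReesMatrixSemigroup G A B C) (RowTuple C 3)).prod
      (permRepresentation k (ReesMatrixSemigroup G A B C) (RowCell C a₀ b₀))).IsCoinvariants
      ((Finsupp.lmapDomain k k (fun x : RowTuple C 3 => TupleOrbit.mk x.tuple)).prodMap
        (Finsupp.lmapDomain k k RowCell.cell)) :=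
  (isCoinvariants_rowTuple k hC 3).prodMap (isCoinvariants_rowCell k hC)

section

variable [EnoughProjectives (Rep.{max u v w} k (WithOne (ReesMatrixSemigroup G A B C)))]
variable (k)

theorem nonempty_leftDerived_zero (hC : IsNormalized C a₀ b₀) :
    Nonempty (((Rep.coinvariantsFunctor.{max u v w} k (WithOne (ReesMatrixSemigroup G A B C))
      ).leftDerived 0).obj (Rep.trivial k _ (ULift.{max u v w} k)) ≃+
      MiddleHomology (orbitD k G 1) (0 : (TupleOrbit G 1 →₀ k) →ₗ[k] (TupleOrbit G 1 →₀ k))) :=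
  (resolution k hC).nonempty_leftDerived_zero_of_isCoinvariants
    (isCoinvariants_rowTuple k hC 1) (isCoinvariants_resolution_one hC) fun x => by
      change Finsupp.lmapDomain k k _ (rowD C k 1 x.1 + complementToTuple C a₀ b₀ k x.2) = _
      rw [map_add, lmapDomain_complementToTuple, add_zero, ← orbitD_lmapDomain]
      rfl

theorem nonempty_leftDerived_one (hC : IsNormalized C a₀ b₀) :
    Nonempty (((Rep.coinvariantsFunctor.{max u v w} k (WithOne (ReesMatrixSemigroup G A B C))
      ).leftDerived 1).obj (Rep.trivial k _ (ULift.{max u v w} k)) ≃+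
      MiddleHomology (orbitCellD C a₀ b₀ k) (orbitD k G 1)) :=
  (resolution k hC).nonempty_leftDerived_succ_of_isCoinvariants (n := 0)
    (isCoinvariants_rowTuple k hC 1) (isCoinvariants_resolution_one hC)
    (isCoinvariants_resolution_two hC) (fun x => by
      change Finsupp.lmapDomain k k _ (rowD C k 1 x.1 + complementToTuple C a₀ b₀ k x.2) = _
      rw [map_add, lmapDomain_complementToTuple, add_zero, ← orbitD_lmapDomain]
      rfl)
    (fun x => by
      change Finsupp.lmapDomain k k _ (rowD C k 2 x.1 + cellToTuple C a₀ b₀ k x.2) = _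
      rw [map_add, lmapDomain_cellToTuple, ← orbitD_lmapDomain]
      rfl)

theorem nonempty_leftDerived_two (hC : IsNormalized C a₀ b₀) :
    Nonempty (((Rep.coinvariantsFunctor.{max u v w} k (WithOne (ReesMatrixSemigroup G A B C))
      ).leftDerived 2).obj (Rep.trivial k _ (ULift.{max u v w} k)) ≃+
      MiddleHomology (LinearMap.inl k _ _ ∘ₗ orbitD k G 3) (orbitCellD C a₀ b₀ k)) :=
  (resolution k hC).nonempty_leftDerived_succ_of_isCoinvariants (n := 1)
    (isCoinvariants_resolution_one hC) (isCoinvariants_resolution_two hC)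
    (isCoinvariants_rowTuple k hC 4) (fun x => by
      change Finsupp.lmapDomain k k _ (rowD C k 2 x.1 + cellToTuple C a₀ b₀ k x.2) = _
      rw [map_add, lmapDomain_cellToTuple, ← orbitD_lmapDomain]
      rfl)
    (lmapDomain_inl_rowD (a₀ := a₀) (b₀ := b₀))

theorem nonempty_leftDerived_three (hC : IsNormalized C a₀ b₀) :
    Nonempty (((Rep.coinvariantsFunctor.{max u v w} k (WithOne (ReesMatrixSemigroup G A B C))
      ).leftDerived 3).obj (Rep.trivial k _ (ULift.{max u v w} k)) ≃+
      MiddleHomology (orbitD k G 4) (LinearMap.inl k _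
        ({a : A // a ≠ a₀} × {b : B // b ≠ b₀} →₀ k) ∘ₗ orbitD k G 3)) :=
  (resolution k hC).nonempty_leftDerived_succ_of_isCoinvariants (n := 2)
    (isCoinvariants_resolution_two hC) (isCoinvariants_rowTuple k hC 4)
    (isCoinvariants_rowTuple k hC 5) (lmapDomain_inl_rowD (a₀ := a₀) (b₀ := b₀))
      (fun x => (orbitD_lmapDomain 4 x).symm)

theorem nonempty_leftDerived_add_four (hC : IsNormalized C a₀ b₀) (n : ℕ) :
    Nonempty (((Rep.coinvariantsFunctor.{max u v w} k (WithOne (ReesMatrixSemigroup G A B C))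
      ).leftDerived (n + 4)).obj (Rep.trivial k _ (ULift.{max u v w} k)) ≃+
      MiddleHomology (orbitD k G (n + 5)) (orbitD k G (n + 4))) :=
  (resolution k hC).nonempty_leftDerived_succ_of_isCoinvariants (n := n + 3)
    (isCoinvariants_rowTuple k hC (n + 4)) (isCoinvariants_rowTuple k hC (n + 5))
    (isCoinvariants_rowTuple k hC (n + 6)) (fun x => (orbitD_lmapDomain (n + 4) x).symm)
      (fun x => (orbitD_lmapDomain (n + 5) x).symm)

end
end ReesMatrixSemigroup

end

/-! ### Submodules of free modules over a principal ideal domain. -/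

section

variable {R J : Type*} [CommRing R] [IsDomain R] [IsPrincipalIdealRing R]

/-- Submodules of free modules over principal ideal domains are free. -/
theorem Submodule.free_of_finsupp (N : Submodule R (J →₀ R)) : Module.Free R N := by
  classical
  obtain ⟨_, _⟩ := exists_wellFoundedLT J
  let L (j : J) : Submodule R (J →₀ R) := N ⊓ Finsupp.supported R R (Set.Iic j)
  -- The j-th coefficients of `L j` form an ideal; `b j` will realize a generator of it. The `b j`
  -- with nonzero coefficient at j form the basis.
  have hL (j) : ∃ x ∈ L j, ∀ y ∈ L j, x j ∣ y j := by
    obtain ⟨d, hd⟩ := (IsPrincipalIdealRing.principal ((L j).map (Finsupp.lapply j))).1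
    obtain ⟨x, hx, rfl⟩ := Submodule.mem_map.1 (hd ▸ Submodule.mem_span_singleton_self d)
    refine ⟨x, hx, fun y hy => ?_⟩
    obtain ⟨c, hc⟩ := Submodule.mem_span_singleton.1 (hd ▸ Submodule.mem_map_of_mem hy)
    exact ⟨c, by rw [mul_comm]; exact hc.symm⟩
  choose b hb hdvd using hL
  let c (t : {j // b j j ≠ 0}) : N := ⟨b t, (hb t).1⟩
  have hlt {i j : J} (h : i < j) : b i j = 0 :=
    Finsupp.notMem_support_iff.1 fun hj => h.not_ge ((hb i).2 hj)
  have hc : LinearIndependent R fun t : {j // b j j ≠ 0} => b t := by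
    refine (injective_iff_map_eq_zero _).2 fun l hl => ?_
    by_contra h
    let t := l.support.max' (Finsupp.support_nonempty_iff.2 h)
    have ht : l t ≠ 0 := Finsupp.mem_support_iff.1 (l.support.max'_mem _)
    have e : Finsupp.linearCombination R (fun t : {j // b j j ≠ 0} => b t) l t = l t * b t t := by
      rw [Finsupp.linearCombination_apply, Finsupp.sum, Finsupp.finsetSum_apply]
      refine Finset.sum_eq_single t (fun i hi hit => ?_) fun h => absurd (l.support.max'_mem _) h
      have : (i : J) < t := lt_of_le_of_ne (l.support.le_max' i hi) fun h => hit (Subtype.ext h)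
      simp [hlt this]
    rw [hl] at e
    exact mul_ne_zero ht t.2 e.symm
  refine Module.Free.of_basis (Module.Basis.mk (v := c) (.of_comp N.subtype hc) fun x _ => ?_)
  -- Subtracting a multiple of `b j` kills the coefficient at j and lowers the largest index of the
  -- support, so well-founded induction applies.
  have key (j : J) : ∀ y ∈ L j, y ∈ Submodule.span R (Set.range fun t => (c t : J →₀ R)) := by
    induction j using WellFoundedLT.induction with
    | ind j ih =>
      intro y hy
      obtain ⟨r, hr⟩ := hdvd j y hy
      obtain ⟨z, hz, hzL, hzj⟩ : ∃ z ∈ Submodule.span R (Set.range fun t => (c t : J →₀ R)),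
          z ∈ L j ∧ z j = y j := by
        by_cases hj : b j j = 0
        · exact ⟨0, zero_mem _, zero_mem _, by simp [hr, hj]⟩
        · exact ⟨r • b j, Submodule.smul_mem _ _ (Submodule.subset_span ⟨⟨j, hj⟩, rfl⟩),
            Submodule.smul_mem _ _ (hb j), by simp [hr, mul_comm]⟩
      rw [← sub_add_cancel y z]
      refine add_mem ?_ hz
      by_cases h0 : y - z = 0
      · rw [h0]
        exact zero_mem _
      have hm : y - z ∈ L j := sub_mem hy hzL
      have hmem := Finset.max'_mem _ (Finsupp.support_nonempty_iff.2 h0)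
      refine ih _ (lt_of_le_of_ne (hm.2 hmem) fun h => ?_) _
        ⟨hm.1, fun i hi => Finset.le_max' _ i hi⟩
      rw [h, Finsupp.mem_support_iff] at hmem
      exact hmem (by simp [hzj])
  have hx : (x : J →₀ R) ∈ Submodule.span R (Set.range fun t => (c t : J →₀ R)) := by
    by_cases h0 : (x : J →₀ R) = 0
    · rw [h0]
      exact zero_mem _
    · exact key (Finset.max' _ (Finsupp.support_nonempty_iff.2 h0)) x
        ⟨x.2, fun i hi => Finset.le_max' _ i hi⟩
  rw [show (Set.range fun t => (c t : J →₀ R)) = N.subtype '' Set.range c by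
    rw [← Set.range_comp]; rfl, Submodule.span_image] at hx
  obtain ⟨x', h, e⟩ := Submodule.mem_map.1 hx
  rwa [← Subtype.ext e]

/-- A submodule of a free module that contains a nonzero multiple of the whole module has full
rank. -/
theorem Submodule.nonempty_linearEquiv_finsupp (N : Submodule R (J →₀ R)) (r : R) (hr : r ≠ 0)
    (h : ∀ x, r • x ∈ N) : Nonempty (N ≃ₗ[R] (J →₀ R)) := by
  have := N.free_of_finsupp
  refine nonempty_linearEquiv_of_rank_eq (le_antisymm (Submodule.rank_le N) ?_)
  -- Multiplication by `r` embeds the whole module in `N`.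
  exact LinearMap.rank_le_of_injective
    ((LinearMap.lsmul R (J →₀ R) r).codRestrict N h)
    fun x y hxy => smul_right_injective _ hr (congr_arg Subtype.val hxy)

end

theorem MiddleHomology.nonempty_addEquiv_of_ker_eq {R X Y Z Z' : Type*} [Ring R] [AddCommGroup X]
    [AddCommGroup Y] [AddCommGroup Z] [AddCommGroup Z'] [Module R X] [Module R Y] [Module R Z]
    [Module R Z'] (f : X →ₗ[R] Y) {g : Y →ₗ[R] Z} {g' : Y →ₗ[R] Z'}
    (h : LinearMap.ker g = LinearMap.ker g') :
    Nonempty (MiddleHomology f g ≃+ MiddleHomology f g') := by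
  unfold MiddleHomology
  rw [h]
  exact ⟨AddEquiv.refl _⟩

/-! ### The group complex in degrees 0 and 1. -/

section

variable (G : Type u) [Group G]

instance : Subsingleton (TupleOrbit G 1) := by
  refine ⟨fun x y => ?_⟩
  obtain ⟨x, rfl⟩ := TupleOrbit.mk_surjective x
  obtain ⟨y, rfl⟩ := TupleOrbit.mk_surjective y
  refine TupleOrbit.mk_eq_iff.2 ⟨x 0 * (y 0)⁻¹, ?_⟩
  ext i
  simp [Subsingleton.elim i 0]

/-- The homomorphism `ℤ[G²/G] → G^ab` that sends the orbit of `(g, h)` to the class of `g⁻¹h`. -/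
noncomputable def orbitToAbelianization :
    (TupleOrbit G 2 →₀ ℤ) →ₗ[ℤ] Additive (Abelianization G) :=
  Finsupp.linearCombination ℤ (Quotient.lift
    (fun x => Additive.ofMul (Abelianization.of ((x 0)⁻¹ * x 1))) (by
      rintro _ x ⟨g, rfl⟩
      simp [mul_assoc]))

variable {G}

@[simp]
theorem orbitToAbelianization_single (g h : G) (n : ℤ) :
    orbitToAbelianization G (Finsupp.single (TupleOrbit.mk ![g, h]) n) =
      n • Additive.ofMul (Abelianization.of (g⁻¹ * h)) :=
  Finsupp.linearCombination_single ..

theorem orbit_induction {k : Type} [CommRing k] {n : ℕ} {p : (TupleOrbit G n →₀ k) → Prop} (x)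
    (zero : p 0) (add : ∀ x y, p x → p y → p (x + y))
    (single : ∀ x r, p (Finsupp.single (TupleOrbit.mk x) r)) : p x := by
  induction x using Finsupp.induction_linear with
  | zero => exact zero
  | add x y hx hy => exact add x y hx hy
  | single x r =>
    obtain ⟨x, rfl⟩ := TupleOrbit.mk_surjective x
    exact single x r

theorem orbitD_one {k : Type} [CommRing k] : orbitD k G 1 = 0 := by
  refine LinearMap.ext fun x => ?_
  induction x using orbit_induction with
  | zero => simp
  | add x y hx hy => rw [map_add, hx, hy, map_add]
  | single x r =>
    rw [← tupleProj_single, orbitD_proj]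
    simp only [tupleD, Finsupp.linearCombination_single, map_smul, map_sub, tupleProj_single,
      Finsupp.lmapDomain_apply, Finsupp.mapDomain_single]
    rw [sub_eq_zero.2 (congr_arg (Finsupp.single · _) (Subsingleton.elim _ _)), smul_zero,
      LinearMap.zero_apply]

theorem orbitD_two_single {k : Type} [CommRing k] (a b c : G) (r : k) :
    orbitD k G 2 (Finsupp.single (TupleOrbit.mk ![a, b, c]) r) =
      Finsupp.single (TupleOrbit.mk ![b, c]) r - Finsupp.single (TupleOrbit.mk ![a, c]) r +
        Finsupp.single (TupleOrbit.mk ![a, b]) r := by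
  have e : Finsupp.single ![a, b, c] r = tupleCons k a 2 (tupleCons k b 1
      (tupleCons k c 0 (Finsupp.single ![] r))) := by
    simp
  rw [← tupleProj_single, orbitD_proj, e, tupleD_succ_cons, tupleD_succ_cons, tupleD_zero_cons]
  simp
  abel

theorem orbitToAbelianization_orbitD (x : TupleOrbit G 3 →₀ ℤ) :
    orbitToAbelianization G (orbitD ℤ G 2 x) = 0 := by
  induction x using orbit_induction with
  | zero => simp
  | add x y hx hy => rw [map_add, map_add, hx, hy, add_zero]
  | single x n =>
    obtain ⟨a, b, c, rfl⟩ : ∃ a b c, x = ![a, b, c] :=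
      ⟨x 0, x 1, x 2, by ext i; fin_cases i <;> rfl⟩
    simp only [orbitD_two_single, map_add, map_sub, orbitToAbelianization_single, map_mul, map_inv,
      ofMul_mul, ofMul_inv, smul_add, smul_neg]
    abel

theorem orbitToAbelianization_surjective : Function.Surjective (orbitToAbelianization G) := by
  intro x
  obtain ⟨g, hg⟩ := QuotientGroup.mk_surjective x.toMul
  refine ⟨Finsupp.single (TupleOrbit.mk ![1, g]) 1, ?_⟩
  rw [orbitToAbelianization_single, one_smul, inv_one, one_mul]
  exact congr_arg Additive.ofMul hg

/-- This is the injectivity of H₁(G) → G^ab, proved by constructing a left inverse from G^ab to the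
1-chains modulo boundaries. -/
theorem exists_orbitD_eq (x : TupleOrbit G 2 →₀ ℤ) (hx : orbitToAbelianization G x = 0) :
    ∃ y, orbitD ℤ G 2 y = x := by
  let Q := (TupleOrbit G 2 →₀ ℤ) ⧸ LinearMap.range (orbitD ℤ G 2)
  have hQ (a b c : G) : (Submodule.Quotient.mk (Finsupp.single (TupleOrbit.mk ![b, c]) 1) -
      Submodule.Quotient.mk (Finsupp.single (TupleOrbit.mk ![a, c]) 1) +
        Submodule.Quotient.mk (Finsupp.single (TupleOrbit.mk ![a, b]) 1) : Q) = 0 := by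
    rw [← Submodule.Quotient.mk_sub, ← Submodule.Quotient.mk_add, ← orbitD_two_single,
      Submodule.Quotient.mk_eq_zero]
    exact ⟨_, rfl⟩
  have hmk (a b c : G) : TupleOrbit.mk ![a * b, a * c] = TupleOrbit.mk ![b, c] :=
    TupleOrbit.mk_eq_iff.2 ⟨a, by ext i; fin_cases i <;> simp⟩
  -- Multiplicativity is the boundary relation of the triple (1, g, gh). `Q` is commutative, so `F`
  -- factors through G^ab.
  let F : G →* Multiplicative Q := MonoidHom.mk'
    (fun g => Multiplicative.ofAdd (Submodule.Quotient.mk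
      (Finsupp.single (TupleOrbit.mk ![1, g]) 1))) fun g h => by
    rw [← ofAdd_add]
    congr 1
    have := hQ 1 g (g * h)
    have e := hmk g 1 h
    rw [mul_one] at e
    rw [e, sub_add_eq_add_sub, sub_eq_zero] at this
    rw [← this, add_comm]
  let Φ : Additive (Abelianization G) →ₗ[ℤ] Q :=
    (MonoidHom.toAdditive (Abelianization.lift F) : _ →+ Q).toIntLinearMap
  have h (y : TupleOrbit G 2 →₀ ℤ) : Φ (orbitToAbelianization G y) = Submodule.Quotient.mk y := by
    induction y using orbit_induction with
    | zero => simp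
    | add x y hx hy => rw [map_add, map_add, hx, hy, Submodule.Quotient.mk_add]
    | single x n =>
      obtain ⟨a, b, rfl⟩ : ∃ a b, x = ![a, b] := ⟨x 0, x 1, by ext i; fin_cases i <;> rfl⟩
      have e := hmk a 1 (a⁻¹ * b)
      rw [mul_one, mul_inv_cancel_left] at e
      rw [orbitToAbelianization_single, map_smul, e, Finsupp.eq_smul_single_one,
        Submodule.Quotient.mk_smul]
      rfl
  have := h x
  rw [hx, map_zero, eq_comm, Submodule.Quotient.mk_eq_zero] at this
  exact this

theorem nonempty_middleHomology_orbitD_one :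
    Nonempty (MiddleHomology (orbitD ℤ G 1) (0 : (TupleOrbit G 1 →₀ ℤ) →ₗ[ℤ] (TupleOrbit G 1 →₀ ℤ))
      ≃+ ℤ) := by
  let e := Finsupp.uniqueLinearEquiv ℤ ℤ (TupleOrbit.mk (fun _ => 1 : Fin 1 → G))
  refine MiddleHomology.nonempty_addEquiv_of_surjective _ _
    (e.toLinearMap ∘ₗ (LinearMap.ker _).subtype) (fun n => ⟨⟨e.symm n, rfl⟩, by simp⟩) fun y => ?_
  rw [orbitD_one]
  exact ⟨fun h => ⟨0, (e.map_eq_zero_iff.1 h).symm⟩, fun ⟨_, h⟩ => e.map_eq_zero_iff.2 h.symm⟩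

end

/-! ### Homology of the complex of coinvariants in terms of ψ. -/

namespace ReesMatrixSemigroup

variable {G : Type u} {A : Type v} {B : Type w} [Group G] {C : Matrix B A G} {a₀ : A} {b₀ : B}

theorem orbitCellD_apply (x) :
    orbitCellD C a₀ b₀ ℤ x = orbitD ℤ G 2 x.1 + cellBoundary C a₀ b₀ ℤ x.2 :=
  LinearMap.coprod_apply ..

theorem orbitToAbelianization_cellBoundary (x) :
    orbitToAbelianization G (cellBoundary C a₀ b₀ ℤ x) = psi C a₀ b₀ x := by
  induction x using Finsupp.induction_linear with
  | zero => simp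
  | add x y hx hy => simp only [map_add, hx, hy]
  | single x n => simp [cellBoundary, psi]

theorem orbitToAbelianization_orbitCellD (x) :
    orbitToAbelianization G (orbitCellD C a₀ b₀ ℤ x) = psi C a₀ b₀ x.2 := by
  rw [orbitCellD_apply, map_add, orbitToAbelianization_orbitD,
    orbitToAbelianization_cellBoundary, zero_add]

theorem nonempty_middleHomology_one :
    Nonempty (MiddleHomology (orbitCellD C a₀ b₀ ℤ) (orbitD ℤ G 1) ≃+
      (Additive (Abelianization G) ⧸ LinearMap.range (psi C a₀ b₀))) := by
  refine MiddleHomology.nonempty_addEquiv_of_surjective _ _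
    (Submodule.mkQ _ ∘ₗ orbitToAbelianization G ∘ₗ Submodule.subtype _) (fun x => ?_) fun y => ?_
  · obtain ⟨x, rfl⟩ := Submodule.Quotient.mk_surjective _ x
    obtain ⟨y, rfl⟩ := orbitToAbelianization_surjective x
    exact ⟨⟨y, by rw [orbitD_one]; rfl⟩, rfl⟩
  · simp only [LinearMap.comp_apply, Submodule.mkQ_apply, Submodule.Quotient.mk_eq_zero,
      Submodule.subtype_apply]
    constructor
    · rintro ⟨j, hj⟩
      rw [← orbitToAbelianization_cellBoundary, eq_comm, ← sub_eq_zero, ← map_sub] at hj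
      obtain ⟨z, hz⟩ := exists_orbitD_eq _ hj
      exact ⟨(z, j), by rw [orbitCellD_apply, hz, sub_add_cancel]⟩
    · rintro ⟨z, hz⟩
      exact ⟨z.2, by rw [← hz, orbitToAbelianization_orbitCellD]⟩

/-- A 2-cycle is a group chain together with cells whose boundaries cancel; the possible cell parts
are exactly ker ψ. The group cycles are the kernel of this projection, and boundaries have no cell
part. -/
theorem nonempty_middleHomology_two :
    Nonempty (MiddleHomology (LinearMap.inl ℤ _ _ ∘ₗ orbitD ℤ G 3) (orbitCellD C a₀ b₀ ℤ) ≃+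
      (MiddleHomology (orbitD ℤ G 3) (orbitD ℤ G 2) × LinearMap.ker (psi C a₀ b₀))) := by
  let p : LinearMap.ker (orbitCellD C a₀ b₀ ℤ) →ₗ[ℤ] LinearMap.ker (psi C a₀ b₀) :=
    (LinearMap.snd ℤ _ _ ∘ₗ Submodule.subtype _).codRestrict _ fun x => by
      rw [LinearMap.mem_ker, LinearMap.comp_apply, LinearMap.snd_apply,
        ← orbitToAbelianization_orbitCellD]
      exact (congr_arg _ x.2).trans (map_zero _)
  have hp : Function.Surjective p := by
    rintro ⟨j, hj⟩
    rw [LinearMap.mem_ker, ← orbitToAbelianization_cellBoundary] at hj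
    obtain ⟨z, hz⟩ := exists_orbitD_eq _ hj
    refine ⟨⟨(-z, j), ?_⟩, rfl⟩
    rw [LinearMap.mem_ker, orbitCellD_apply, map_neg, hz, neg_add_cancel]
  -- Freeness of ker ψ gives the section `s` that splits the extension; `t` is then the projection
  -- onto the group cycles.
  have := (LinearMap.ker (psi C a₀ b₀)).free_of_finsupp
  obtain ⟨s, hs⟩ := Module.projective_lifting_property p LinearMap.id hp
  replace hs (j) : p (s j) = j := LinearMap.congr_fun hs j
  have hzero (v : LinearMap.ker (orbitCellD C a₀ b₀ ℤ)) (hv : p v = 0) :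
      orbitD ℤ G 2 v.1.1 = 0 := by
    have h : v.1.2 = 0 := congr_arg Subtype.val hv
    have := v.2
    rwa [LinearMap.mem_ker, orbitCellD_apply, h, map_zero, add_zero] at this
  have hsub (v) : p (v - s (p v)) = 0 := by rw [map_sub, hs, sub_self]
  let t : LinearMap.ker (orbitCellD C a₀ b₀ ℤ) →ₗ[ℤ] LinearMap.ker (orbitD ℤ G 2) :=
    (LinearMap.fst ℤ _ _ ∘ₗ Submodule.subtype _ ∘ₗ (LinearMap.id - s ∘ₗ p)).codRestrict _
      fun v => hzero _ (hsub v)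
  refine MiddleHomology.nonempty_addEquiv_of_surjective _ _
    ((Submodule.mkQ _ ∘ₗ t).prod p) (fun x => ?_) fun y => ?_
  · obtain ⟨x, j⟩ := x
    obtain ⟨⟨x, hx⟩, rfl⟩ := Submodule.Quotient.mk_surjective _ x
    have hx0 : (x, 0) ∈ LinearMap.ker (orbitCellD C a₀ b₀ ℤ) := by
      rw [LinearMap.mem_ker, orbitCellD_apply, map_zero, add_zero]
      exact hx
    have h0 : p ⟨(x, 0), hx0⟩ = 0 := rfl
    refine ⟨⟨(x, 0), hx0⟩ + s j, Prod.ext ?_ ?_⟩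
    · refine congr_arg (Submodule.Quotient.mk) (Subtype.ext ?_)
      change (_ + s j - s (p (_ + s j))).1.1 = x
      rw [map_add, h0, zero_add, hs, add_sub_cancel_right]
    · change p (_ + s j) = j
      rw [map_add, h0, zero_add, hs]
  · rw [Prod.ext_iff]
    change Submodule.Quotient.mk (t y) = 0 ∧ p y = 0 ↔ _
    rw [Submodule.Quotient.mk_eq_zero]
    constructor
    · rintro ⟨⟨x, hx⟩, h⟩
      refine ⟨x, Prod.ext ?_ (congr_arg Subtype.val h).symm⟩
      refine hx.trans ?_
      change (y - s (p y)).1.1 = y.1.1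
      rw [h, map_zero, sub_zero]
    · rintro ⟨x, hx⟩
      have h : p y = 0 := Subtype.ext (congr_arg Prod.snd hx).symm
      refine ⟨⟨x, (congr_arg Prod.fst hx).trans ?_⟩, h⟩
      change y.1.1 = (y - s (p y)).1.1
      rw [h, map_zero, sub_zero]

theorem nonempty_middleHomology_three :
    Nonempty (MiddleHomology (orbitD ℤ G 4) (LinearMap.inl ℤ _
      ({a : A // a ≠ a₀} × {b : B // b ≠ b₀} →₀ ℤ) ∘ₗ orbitD ℤ G 3) ≃+
      MiddleHomology (orbitD ℤ G 4) (orbitD ℤ G 3)) :=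
  MiddleHomology.nonempty_addEquiv_of_ker_eq _
    (LinearMap.ker_comp_of_ker_eq_bot _ (LinearMap.ker_eq_bot.2 LinearMap.inl_injective))

theorem nonempty_ker_psi_of_finite (h : Finite (Subgroup.closure (Set.range
    fun p : {a : A // a ≠ a₀} × {b : B // b ≠ b₀} =>
      (Abelianization.of (C p.2 p.1) : Abelianization G)))) :
    Nonempty (LinearMap.ker (psi C a₀ b₀) ≃+
      (({a : A // a ≠ a₀} × {b : B // b ≠ b₀}) →₀ ℤ)) := by
  let H := Subgroup.closure (Set.range fun p : {a : A // a ≠ a₀} × {b : B // b ≠ b₀} =>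
    (Abelianization.of (C p.2 p.1) : Abelianization G))
  have hmem (x) : (psi C a₀ b₀ x).toMul ∈ H := by
    induction x using Finsupp.induction_linear with
    | zero => simp
    | add x y hx hy =>
      rw [map_add, toMul_add]
      exact mul_mem hx hy
    | single p n =>
      rw [psi, Finsupp.linearCombination_single, toMul_zsmul]
      exact H.zpow_mem (Subgroup.subset_closure (Set.mem_range_self p)) n
  -- The order of `H` annihilates the image of ψ, so ker ψ contains that multiple of every element.
  obtain ⟨e⟩ := (LinearMap.ker (psi C a₀ b₀)).nonempty_linearEquiv_finsupp (Nat.card H : ℤ)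
    (by exact_mod_cast Nat.card_pos.ne') fun x => by
      rw [LinearMap.mem_ker, map_smul, natCast_zsmul]
      exact congr_arg (fun h : H => Additive.ofMul h.1) (pow_card_eq_one' (x := (⟨_, hmem x⟩ : H)))
  exact ⟨e.toAddEquiv⟩

end ReesMatrixSemigroup

/-! ### Assembly of the theorem. -/

theorem theoremA {G : Type u} {A : Type v} {B : Type w} [Group G] (C : Matrix B A G)
    (a₀ : A) (b₀ : B) (hC : ReesMatrixSemigroup.IsNormalized C a₀ b₀) :
    Nonempty (semigroupHomology (ReesMatrixSemigroup G A B C) 0 ≃+ ℤ) ∧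
    Nonempty (semigroupHomology (ReesMatrixSemigroup G A B C) 1 ≃+
      (Additive (Abelianization G) ⧸ LinearMap.range (ReesMatrixSemigroup.psi C a₀ b₀))) ∧
    Nonempty (semigroupHomology (ReesMatrixSemigroup G A B C) 2 ≃+
      (monoidHomology G 2 × LinearMap.ker (ReesMatrixSemigroup.psi C a₀ b₀))) ∧
    (∀ n : ℕ, 3 ≤ n →
      Nonempty (semigroupHomology (ReesMatrixSemigroup G A B C) n ≃+ monoidHomology G n)) ∧
    (Finite (Subgroup.closure (Set.range
        fun p : {a : A // a ≠ a₀} × {b : B // b ≠ b₀} =>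
          (Abelianization.of (C p.2 p.1) : Abelianization G))) →
      Nonempty (LinearMap.ker (ReesMatrixSemigroup.psi C a₀ b₀) ≃+
        (({a : A // a ≠ a₀} × {b : B // b ≠ b₀}) →₀ ℤ)) ∧
      Nonempty (semigroupHomology (ReesMatrixSemigroup G A B C) 2 ≃+
        (monoidHomology G 2 × (({a : A // a ≠ a₀} × {b : B // b ≠ b₀}) →₀ ℤ)))) := by
  have h₂ : Nonempty (semigroupHomology (ReesMatrixSemigroup G A B C) 2 ≃+
      (monoidHomology G 2 × LinearMap.ker (ReesMatrixSemigroup.psi C a₀ b₀))) := by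
    obtain ⟨e⟩ := ReesMatrixSemigroup.nonempty_leftDerived_two ℤ hC
    obtain ⟨e'⟩ := ReesMatrixSemigroup.nonempty_middleHomology_two (C := C) (a₀ := a₀) (b₀ := b₀)
    obtain ⟨f⟩ := nonempty_leftDerived_group ℤ G 1
    exact ⟨(e.trans e').trans (f.symm.prodCongr (AddEquiv.refl _))⟩
  refine ⟨?_, ?_, h₂, fun n hn => ?_, fun h => ?_⟩
  · obtain ⟨e⟩ := ReesMatrixSemigroup.nonempty_leftDerived_zero ℤ hC
    obtain ⟨e'⟩ := nonempty_middleHomology_orbitD_one (G := G)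
    exact ⟨e.trans e'⟩
  · obtain ⟨e⟩ := ReesMatrixSemigroup.nonempty_leftDerived_one ℤ hC
    obtain ⟨e'⟩ := ReesMatrixSemigroup.nonempty_middleHomology_one (C := C) (a₀ := a₀) (b₀ := b₀)
    exact ⟨e.trans e'⟩
  · obtain ⟨n, rfl⟩ := Nat.exists_eq_add_of_le' hn
    -- Degree 3 is separate: its differential lands in degree 2, which has the additional cell
    -- summand.
    cases n with
    | zero =>
      obtain ⟨e⟩ := ReesMatrixSemigroup.nonempty_leftDerived_three ℤ hC
      obtain ⟨e'⟩ := ReesMatrixSemigroup.nonempty_middleHomology_three (G := G) (a₀ := a₀) (b₀ := b₀)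
      obtain ⟨f⟩ := nonempty_leftDerived_group ℤ G 2
      exact ⟨(e.trans e').trans f.symm⟩
    | succ n =>
      obtain ⟨e⟩ := ReesMatrixSemigroup.nonempty_leftDerived_add_four ℤ hC n
      obtain ⟨f⟩ := nonempty_leftDerived_group ℤ G (n + 3)
      exact ⟨e.trans f.symm⟩
  · obtain ⟨e⟩ := ReesMatrixSemigroup.nonempty_ker_psi_of_finite h
    obtain ⟨f⟩ := h₂
    exact ⟨⟨e⟩, ⟨f.trans ((AddEquiv.refl _).prodCongr e)⟩⟩
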